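/- Let $n\ge 2$ be even and let $p$ be a real number (for the involution walk, $p\in[0,1]$). For a partition $\lambda$ of an integer $m$ let $\chi_\lambda$ be the character of the irreducible complex representation of the symmetric group $S_m$ indexed by $\lambda$, let $d_\lambda$ be its dimension, and write $\chi_\lambda(1^{m-2s},2^s)$ for its value on the permutations with $s$ cycles of length $2$ and $m-2s$ fixed points. For $m$ even, define the eigenvalue of the involution walk $$\psi_\lambda=\sum_{s=0}^{m/2}p^{m/2-s}(1-p)^s\binom{m/2}{s}\frac{\chi_\lambda(1^{m-2s},2^s)}{d_\lambda}.$$ Then for every partition $\lambda$ of $n$, $$\psi_\lambda=\sum_{\rho:\,\lambda/\rho=[2]}\psi_\rho\frac{d_\rho}{d_\lambda}+(2p-1)\sum_{\rho:\,\lambda/\rho=[1,1]}\psi_\rho\frac{d_\rho}{d_\lambda}+2p\sum_{\rho:\,\lambda/\rho=[1]\cup[1]}\psi_\rho\frac{d_\rho}{d_\lambda}.$$ The sums run over the partitions $\rho$ of $n-2$ whose Young diagram is contained in that of $\lambda$ and for which the two boxes of $\lambda/\rho$ are, respectively, two adjacent boxes in one row ($\lambda/\rho=[2]$), two adjacent boxes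 in one column ($\lambda/\rho=[1,1]$), or two boxes in different rows and different columns ($\lambda/\rho=[1]\cup[1]$); each such $\rho$ is counted once. -/

import Mathlib

namespace InvolutionWalk

open scoped MonoidAlgebra Classical

noncomputable section

/-! ### Irreducible representations of the symmetric group -/

section Specht

variable {α : Type*} [Fintype α] [DecidableEq α] {lam : YoungDiagram}

/-- For a bijective filling `T` of the boxes of a Young diagram by the elements of `α`
(`T a` is the box that contains `a`), the permutations that keep every element in its row. -/
def rowPerms (T : α ≃ lam.cells) : Finset (Equiv.Perm α) :=
  Finset.univ.filter fun g => ∀ a, (T (g a)).1.1 = (T a).1.1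

/-- The permutations that keep every element in its column. -/
def colPerms (T : α ≃ lam.cells) : Finset (Equiv.Perm α) :=
  Finset.univ.filter fun g => ∀ a, (T (g a)).1.2 = (T a).1.2

/-- The Young symmetrizer of a filling: the sum of the row permutations times the signed sum of
the column permutations, an element of the group algebra. -/
def youngSymmetrizer (T : α ≃ lam.cells) : ℂ[Equiv.Perm α] :=
  (∑ g ∈ rowPerms T, MonoidAlgebra.single g 1) *
    ∑ g ∈ colPerms T, MonoidAlgebra.single g ((Equiv.Perm.sign g : ℤ) : ℂ)

/-- The left regular representation is left multiplication in the group algebra. -/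
theorem leftRegular_apply {G : Type*} [Group G] (g : G) (x : ℂ[G]) :
    Representation.leftRegular ℂ G g x = MonoidAlgebra.single g 1 * x := by
  induction x using MonoidAlgebra.induction_linear with
  | zero => simp
  | add x y hx hy => rw [map_add, mul_add, hx, hy]
  | single h r => simp [MonoidAlgebra.single_mul_single]

/-- The Specht module of a filling `T`: the left ideal of the group algebra that is generated by
the Young symmetrizer `c`, that is `{x * c}`, as a subrepresentation of the left regular
representation. It is the irreducible representation of the symmetric group that is indexed by the
shape of `T`. -/
def spechtModule (T : α ≃ lam.cells) :
    Subrepresentation (Representation.leftRegular ℂ (Equiv.Perm α)) where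
  toSubmodule := LinearMap.range (LinearMap.mulRight ℂ (youngSymmetrizer T))
  apply_mem_toSubmodule := by
    rintro g _ ⟨x, rfl⟩
    exact ⟨MonoidAlgebra.single g 1 * x, by
      rw [leftRegular_apply, LinearMap.mulRight_apply, LinearMap.mulRight_apply, mul_assoc]⟩

end Specht

/-- A fixed filling of the boxes of `lam` by `0, …, n - 1`, where `n` is the number of boxes;
another choice gives an isomorphic representation. -/
def tableau (lam : YoungDiagram) : Fin lam.card ≃ lam.cells :=
  lam.cells.equivFin.symm

/-- The irreducible representation of `S_n` indexed by the partition `lam` of `n`. -/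
def irrep (lam : YoungDiagram) :
    Representation ℂ (Equiv.Perm (Fin lam.card)) (spechtModule (tableau lam)).toSubmodule :=
  (spechtModule (tableau lam)).toRepresentation

/-- The dimension `d_lam` of the irreducible representation indexed by `lam`. -/
def dim (lam : YoungDiagram) : ℕ :=
  Module.finrank ℂ (spechtModule (tableau lam)).toSubmodule

/-- The value `χ_lam(1^{n-2s}, 2^s)` of the irreducible character indexed by `lam` on the
conjugacy class of the permutations that have `s` cycles of length `2` and otherwise only fixed
points (`0` if there is no such permutation, that is if `2 * s > n`). -/
def charInvolution (lam : YoungDiagram) (s : ℕ) : ℂ :=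
  if h : ∃ g : Equiv.Perm (Fin lam.card), g.cycleType = Multiset.replicate s 2 then
    (irrep lam).character h.choose
  else 0

/-- The value on the class is the value at any of its elements. -/
theorem charInvolution_eq (lam : YoungDiagram) (s : ℕ) (g : Equiv.Perm (Fin lam.card))
    (hg : g.cycleType = Multiset.replicate s 2) :
    charInvolution lam s = (irrep lam).character g := by
  have h : ∃ g : Equiv.Perm (Fin lam.card), g.cycleType = Multiset.replicate s 2 := ⟨g, hg⟩
  rw [charInvolution, dif_pos h]
  have hc : IsConj h.choose g := by
    rw [Equiv.Perm.isConj_iff_cycleType_eq, h.choose_spec, hg]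
  obtain ⟨c, hc⟩ := isConj_iff.1 hc
  rw [← hc, Representation.char_mul_comm, inv_mul_cancel_left]

/-! ### The eigenvalues of the involution walk -/

/-- The eigenvalue `ψ_lam` of the involution walk on `S_n`, where `n` is the size of `lam`. -/
def psi (p : ℝ) (lam : YoungDiagram) : ℂ :=
  ∑ s ∈ Finset.range (lam.card / 2 + 1),
    (p : ℂ) ^ (lam.card / 2 - s) * (1 - (p : ℂ)) ^ s * ((lam.card / 2).choose s : ℂ) *
      (charInvolution lam s / (dim lam : ℂ))

/-! ### Removing two boxes from a Young diagram -/

theorem finite_subdiagrams (lam : YoungDiagram) : {rho : YoungDiagram | rho ≤ lam}.Finite := by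
  refine Set.Finite.of_finite_image (f := YoungDiagram.cells)
    (lam.cells.powerset.finite_toSet.subset ?_) ?_
  · rintro _ ⟨rho, h, rfl⟩
    simpa using YoungDiagram.cells_subset_iff.2 h
  · intro a _ b _ h
    exact YoungDiagram.ext h

/-- The finite set of Young diagrams contained in `lam`. -/
def subdiagrams (lam : YoungDiagram) : Finset YoungDiagram :=
  (finite_subdiagrams lam).toFinset

/-- `lam / rho = [2]`: two horizontally adjacent boxes (for `rho ≤ lam`). -/
def IsHorizontalDomino (lam rho : YoungDiagram) : Prop :=
  ∃ i j : ℕ, lam.cells \ rho.cells = {(i, j), (i, j + 1)}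

/-- `lam / rho = [1,1]`: two vertically adjacent boxes (for `rho ≤ lam`). -/
def IsVerticalDomino (lam rho : YoungDiagram) : Prop :=
  ∃ i j : ℕ, lam.cells \ rho.cells = {(i, j), (i + 1, j)}

/-- `lam / rho = [1] ∪ [1]`: two boxes in different rows and different columns
(for `rho ≤ lam`). -/
def IsTwoSingleBoxes (lam rho : YoungDiagram) : Prop :=
  ∃ a b : ℕ × ℕ, a.1 ≠ b.1 ∧ a.2 ≠ b.2 ∧ lam.cells \ rho.cells = {a, b}

/-- The `rho` with `lam / rho = [2]`. -/
def horizontalRemovals (lam : YoungDiagram) : Finset YoungDiagram :=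
  (subdiagrams lam).filter (IsHorizontalDomino lam)

/-- The `rho` with `lam / rho = [1,1]`. -/
def verticalRemovals (lam : YoungDiagram) : Finset YoungDiagram :=
  (subdiagrams lam).filter (IsVerticalDomino lam)

/-- The `rho` with `lam / rho = [1] ∪ [1]`; each `rho` counts once, not once per order of removal
of the two boxes. -/
def twoBoxRemovals (lam : YoungDiagram) : Finset YoungDiagram :=
  (subdiagrams lam).filter (IsTwoSingleBoxes lam)

end

end InvolutionWalk

/-! Put $m = n/2$ and multiply the claim by $d_\lambda$. Pascal's rule turns $\psi_\lambda
d_\lambda$ into the binomial sum of order $m-1$ of $p\chi_\lambda(s) + (1-p)\chi_\lambda(s+1)$,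
where $s$ stands for the class with $s$ two-cycles. Take an involution $g \in S_{n-2}$ with $s$
two-cycles and let $\tau$ be the transposition of the two added points. The two values are
$\chi_\lambda(g)$ and $\chi_\lambda(g\tau)$. The first is the sum of $\chi_\sigma(g)$ over all paths
$\lambda \to \rho \to \sigma$ that remove one box at a time. The second is the same sum with each
path weighted by $1/(c(\lambda/\rho) - c(\rho/\sigma))$, where $c$ is the content
(`charInvolution_recursion`). A horizontal domino has one path, of weight $1$; a vertical domino has
one path, of weight $-1$; two separate boxes have two paths of opposite weights. If $H$, $V$, $T$
are the sums of $\chi_\sigma(g)$ over the three kinds, the result is $p(H+V+2T) + (1-p)(H-V) = H +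
(2p-1)V + 2pT$.

The weights come from $\tau X = Y\tau + 1$ for the last two Jucys–Murphy elements $X$, $Y$,
compressed to a path on which both act by contents (`axialDistance_smul`). The branching rule rests
on two inequalities: the smaller Specht modules embed in the restriction of a Specht module and the
larger ones in its induction, in distinct eigenspaces in both cases. Counting paths in Young's
lattice forces equality (`eq_sum_lowerCovers`). -/

namespace InvolutionWalk

open scoped MonoidAlgebra Classical

noncomputable section

set_option linter.unusedSectionVars false

/-! ### Young symmetrizers and the simplicity of their left ideals -/

section Symmetrizer

variable {α : Type*} [Fintype α] [DecidableEq α] {lam : YoungDiagram}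

/-- The sum of the row permutations. -/
def rowSum (T : α ≃ lam.cells) : ℂ[Equiv.Perm α] :=
  ∑ g ∈ rowPerms T, MonoidAlgebra.single g 1

/-- The signed sum of the column permutations. -/
def colSum (T : α ≃ lam.cells) : ℂ[Equiv.Perm α] :=
  ∑ g ∈ colPerms T, MonoidAlgebra.single g ((Equiv.Perm.sign g : ℤ) : ℂ)

theorem youngSymmetrizer_eq (T : α ≃ lam.cells) :
    youngSymmetrizer T = rowSum T * colSum T := rfl

theorem mem_rowPerms {T : α ≃ lam.cells} {g : Equiv.Perm α} :
    g ∈ rowPerms T ↔ ∀ a, (T (g a)).1.1 = (T a).1.1 := by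
  simp [rowPerms]

theorem mem_colPerms {T : α ≃ lam.cells} {g : Equiv.Perm α} :
    g ∈ colPerms T ↔ ∀ a, (T (g a)).1.2 = (T a).1.2 := by
  simp [colPerms]

theorem mul_mem_rowPerms {T : α ≃ lam.cells} {g h : Equiv.Perm α} (hg : g ∈ rowPerms T) :
    g * h ∈ rowPerms T ↔ h ∈ rowPerms T := by
  rw [mem_rowPerms] at *
  simp [mem_rowPerms, hg]

theorem mul_mem_colPerms {T : α ≃ lam.cells} {g h : Equiv.Perm α} (hg : g ∈ colPerms T) :
    g * h ∈ colPerms T ↔ h ∈ colPerms T := by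
  rw [mem_colPerms] at *
  simp [mem_colPerms, hg]

theorem mul_mem_colPerms' {T : α ≃ lam.cells} {g h : Equiv.Perm α} (hg : g ∈ colPerms T) :
    h * g ∈ colPerms T ↔ h ∈ colPerms T := by
  rw [mem_colPerms] at hg
  simp only [mem_colPerms, Equiv.Perm.mul_apply]
  refine ⟨fun H a => ?_, fun H a => by rw [H, hg]⟩
  have := H (g⁻¹ a)
  have h2 := hg (g⁻¹ a)
  simp only [← Equiv.Perm.mul_apply, mul_inv_cancel, Equiv.Perm.one_apply] at this h2
  rw [this, h2]

theorem inv_mem_rowPerms {T : α ≃ lam.cells} {g : Equiv.Perm α} (hg : g ∈ rowPerms T) :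
    g⁻¹ ∈ rowPerms T := by
  rw [← mul_mem_rowPerms hg]
  simp [mem_rowPerms]

theorem inv_mem_colPerms {T : α ≃ lam.cells} {g : Equiv.Perm α} (hg : g ∈ colPerms T) :
    g⁻¹ ∈ colPerms T := by
  rw [← mul_mem_colPerms hg]
  simp [mem_colPerms]

theorem single_mul_rowSum (T : α ≃ lam.cells) {g : Equiv.Perm α} (hg : g ∈ rowPerms T) :
    MonoidAlgebra.single g (1 : ℂ) * rowSum T = rowSum T := by
  rw [rowSum, Finset.mul_sum]
  refine Finset.sum_equiv (Equiv.mulLeft g) (fun h => (mul_mem_rowPerms hg).symm) fun h _ => ?_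
  simp [MonoidAlgebra.single_mul_single]

theorem sign_mul_sign_self {g : Equiv.Perm α} :
    ((Equiv.Perm.sign g : ℤ) : ℂ) * ((Equiv.Perm.sign g : ℤ) : ℂ) = 1 := by
  rcases Int.units_eq_one_or (Equiv.Perm.sign g) with h | h <;> simp [h]

theorem colSum_mul_single (T : α ≃ lam.cells) {g : Equiv.Perm α} (hg : g ∈ colPerms T) :
    colSum T * MonoidAlgebra.single g (1 : ℂ) = ((Equiv.Perm.sign g : ℤ) : ℂ) • colSum T := by
  rw [colSum, Finset.sum_mul, Finset.smul_sum]
  refine Finset.sum_equiv (Equiv.mulRight g) (fun h => (mul_mem_colPerms' hg).symm) fun h _ => ?_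
  simp [MonoidAlgebra.single_mul_single, mul_comm ((Equiv.Perm.sign h : ℤ) : ℂ), ← mul_assoc,
    sign_mul_sign_self]

theorem card_rowPerms_ne_zero (T : α ≃ lam.cells) : ((rowPerms T).card : ℂ) ≠ 0 := by
  rw [Nat.cast_ne_zero, Finset.card_ne_zero]
  exact ⟨1, by simp [mem_rowPerms]⟩

theorem card_colPerms_ne_zero (T : α ≃ lam.cells) : ((colPerms T).card : ℂ) ≠ 0 := by
  rw [Nat.cast_ne_zero, Finset.card_ne_zero]
  exact ⟨1, by simp [mem_colPerms]⟩

theorem single_mul_youngSymmetrizer (T : α ≃ lam.cells) {g : Equiv.Perm α}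
    (hg : g ∈ rowPerms T) :
    MonoidAlgebra.single g (1 : ℂ) * youngSymmetrizer T = youngSymmetrizer T := by
  rw [youngSymmetrizer_eq, ← mul_assoc, single_mul_rowSum T hg]

theorem youngSymmetrizer_mul_single (T : α ≃ lam.cells) {g : Equiv.Perm α}
    (hg : g ∈ colPerms T) :
    youngSymmetrizer T * MonoidAlgebra.single g (1 : ℂ) =
      ((Equiv.Perm.sign g : ℤ) : ℂ) • youngSymmetrizer T := by
  rw [youngSymmetrizer_eq, mul_assoc, colSum_mul_single T hg, mul_smul_comm]

/-- A permutation that preserves both the row and the column of every element is trivial, so $rq =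
1$ only for $r = q = 1$. -/
theorem coeff_one_youngSymmetrizer (T : α ≃ lam.cells) :
    (youngSymmetrizer T).coeff 1 = 1 := by
  rw [youngSymmetrizer_eq, rowSum, colSum, Finset.sum_mul_sum, MonoidAlgebra.coeff_sum,
    Finsupp.finsetSum_apply]
  simp only [MonoidAlgebra.coeff_sum, Finsupp.finsetSum_apply,
    MonoidAlgebra.single_mul_single, one_mul, MonoidAlgebra.coeff_single, Finsupp.single_apply]
  rw [Finset.sum_eq_single_of_mem 1 (by simp [mem_rowPerms])]
  · rw [Finset.sum_eq_single_of_mem 1 (by simp [mem_colPerms])]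
    · simp
    · intro q _ hq
      simp [hq]
  · intro r hr hr1
    refine Finset.sum_eq_zero fun q hq => if_neg fun h => hr1 ?_
    have hqr : q = r⁻¹ := eq_inv_of_mul_eq_one_right h
    rw [hqr] at hq
    have hr' := inv_mem_colPerms hq
    rw [inv_inv] at hr'
    rw [mem_rowPerms] at hr
    rw [mem_colPerms] at hr'
    ext a
    exact T.injective (Subtype.ext (Prod.ext (hr a) (hr' a)))

/-- Von Neumann's lemma on two fillings: if no two elements in a row of `T` are in a column of
`g T`, then `g` is the product of a row permutation and a column permutation. -/
theorem exists_eq_mul_or_exists_collision (T : α ≃ lam.cells) (g : Equiv.Perm α) :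
    (∃ r ∈ rowPerms T, ∃ q ∈ colPerms T, g = r * q) ∨
      ∃ a b, a ≠ b ∧ (T a).1.1 = (T b).1.1 ∧ (T (g⁻¹ a)).1.2 = (T (g⁻¹ b)).1.2 := by
  refine or_iff_not_imp_right.2 fun hno => ?_
  push Not at hno
  -- In row `i`, count the elements that the filling `g T` puts in the first `k` columns (`P`) and
  -- those that `T` puts there (`Q`). Without a collision the elements of a row have distinct
  -- columns in `g T`, which gives $|P| \le |Q|$.
  let P (i k : ℕ) : Finset α := {a | (T a).1.1 = i ∧ (T (g⁻¹ a)).1.2 < k}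
  let Q (i k : ℕ) : Finset α := {a | (T a).1.1 = i ∧ (T a).1.2 < k}
  have hmem : ∀ a, (T a).1.2 < lam.rowLen (T a).1.1 := fun a =>
    YoungDiagram.mem_iff_lt_rowLen.1 ((YoungDiagram.mem_cells _).1 (T a).2)
  have hle : ∀ i k, (P i k).card ≤ (Q i k).card := by
    intro i k
    rcases le_total k (lam.rowLen i) with hk | hk
    · have hcell : ∀ a ∈ P i k, (i, (T (g⁻¹ a)).1.2) ∈ lam.cells := fun a ha => by
        rw [YoungDiagram.mem_cells, YoungDiagram.mem_iff_lt_rowLen]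
        exact (Finset.mem_filter.1 ha).2.2.trans_le hk
      refine Finset.card_le_card_of_injOn
        (fun a => if h : a ∈ P i k then T.symm ⟨_, hcell a h⟩ else a) ?_ ?_
      · intro a ha
        have ha' : a ∈ P i k := ha
        simp only [ha', dif_pos]
        simpa [Q] using (Finset.mem_filter.1 ha').2.2
      · intro a ha b hb hab
        have ha' : a ∈ P i k := ha
        have hb' : b ∈ P i k := hb
        simp only [ha', hb', dif_pos, EmbeddingLike.apply_eq_iff_eq, Subtype.mk.injEq,
          Prod.mk.injEq, true_and] at hab
        by_contra hne
        exact hno a b hne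
          ((Finset.mem_filter.1 ha').2.1.trans (Finset.mem_filter.1 hb').2.1.symm) hab
    · refine Finset.card_le_card fun a ha => ?_
      simp only [P, Q, Finset.mem_filter, Finset.mem_univ, true_and] at ha ⊢
      exact ⟨ha.1, ((ha.1 ▸ hmem a : _)).trans_le hk⟩
  -- Summed over the rows, both sides count the boxes in the first `k` columns, so the inequality is
  -- an equality in every row.
  have hsum : ∀ k, ∑ i ∈ Finset.univ.image (fun a => (T a).1.1), (P i k).card =
      ∑ i ∈ Finset.univ.image (fun a => (T a).1.1), (Q i k).card := by
    intro k
    have h1 := Finset.card_eq_sum_card_fiberwise (s := {a | (T (g⁻¹ a)).1.2 < k})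
      (t := Finset.univ.image (fun a => (T a).1.1)) (f := fun a => (T a).1.1)
      (fun a _ => by simp)
    have h2 := Finset.card_eq_sum_card_fiberwise (s := {a | (T a).1.2 < k})
      (t := Finset.univ.image (fun a => (T a).1.1)) (f := fun a => (T a).1.1)
      (fun a _ => by simp)
    have h3 : ({a | (T (g⁻¹ a)).1.2 < k} : Finset α).card =
        ({a | (T a).1.2 < k} : Finset α).card :=
      Finset.card_equiv g⁻¹ (by simp)
    simp only [Finset.filter_filter, and_comm] at h1 h2
    simp only [P, Q]
    rw [← h1, ← h2, h3]
  have hcell : ∀ a, ((T a).1.1, (T (g⁻¹ a)).1.2) ∈ lam.cells := by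
    intro a
    -- With `k` the length of the row, `Q` is the whole row, hence so is `P`: the row in `T` and the
    -- column in `g T` of any element meet in a box of the diagram.
    have h1 := (Finset.sum_eq_sum_iff_of_le fun i _ => hle i (lam.rowLen (T a).1.1)).1
      (hsum _) (T a).1.1 (by simp)
    have h2 : P (T a).1.1 (lam.rowLen (T a).1.1) = Q (T a).1.1 (lam.rowLen (T a).1.1) := by
      refine Finset.eq_of_subset_of_card_le (fun b hb => ?_) h1.ge
      simp only [P, Q, Finset.mem_filter, Finset.mem_univ, true_and] at hb ⊢
      exact ⟨hb.1, hb.1 ▸ hmem b⟩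
    have h3 : a ∈ Q (T a).1.1 (lam.rowLen (T a).1.1) := by simpa [Q] using hmem a
    rw [← h2] at h3
    rw [YoungDiagram.mem_cells, YoungDiagram.mem_iff_lt_rowLen]
    exact (Finset.mem_filter.1 h3).2.2
  have hinj : Function.Injective fun a => T.symm ⟨_, hcell a⟩ := by
    intro a b hab
    simp only [EmbeddingLike.apply_eq_iff_eq, Subtype.mk.injEq, Prod.mk.injEq] at hab
    by_contra hne
    exact hno a b hne hab.1 hab.2
  -- Sending each element to the occupant of that box keeps rows and turns columns of `g T` into
  -- columns of `T`; hence `s * g` is a column permutation.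
  let s : Equiv.Perm α := Equiv.ofBijective _ (Finite.injective_iff_bijective.1 hinj)
  have hs : ∀ a, T (s a) = ⟨_, hcell a⟩ := fun a => T.apply_symm_apply _
  refine ⟨s⁻¹, inv_mem_rowPerms (mem_rowPerms.2 fun a => by rw [hs]), s * g,
    mem_colPerms.2 fun a => ?_, by simp⟩
  rw [Equiv.Perm.mul_apply, hs]
  simp

theorem swap_mem_rowPerms {T : α ≃ lam.cells} {a b : α} (h : (T a).1.1 = (T b).1.1) :
    Equiv.swap a b ∈ rowPerms T := by
  rw [mem_rowPerms]
  intro c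
  rcases eq_or_ne c a with rfl | hca
  · rw [Equiv.swap_apply_left, h]
  rcases eq_or_ne c b with rfl | hcb
  · rw [Equiv.swap_apply_right, h]
  rw [Equiv.swap_apply_of_ne_of_ne hca hcb]

theorem swap_mem_colPerms {T : α ≃ lam.cells} {a b : α} (h : (T a).1.2 = (T b).1.2) :
    Equiv.swap a b ∈ colPerms T := by
  rw [mem_colPerms]
  intro c
  rcases eq_or_ne c a with rfl | hca
  · rw [Equiv.swap_apply_left, h]
  rcases eq_or_ne c b with rfl | hcb
  · rw [Equiv.swap_apply_right, h]
  rw [Equiv.swap_apply_of_ne_of_ne hca hcb]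

/-- The elements on which the row permutations act trivially from the left and the column
permutations act by the sign from the right. -/
def IsBiequivariant (T : α ≃ lam.cells) (x : ℂ[Equiv.Perm α]) : Prop :=
  (∀ r ∈ rowPerms T, MonoidAlgebra.single r (1 : ℂ) * x = x) ∧
    ∀ q ∈ colPerms T, x * MonoidAlgebra.single q (1 : ℂ) = ((Equiv.Perm.sign q : ℤ) : ℂ) • x

theorem IsBiequivariant.coeff_mul_left {T : α ≃ lam.cells} {x : ℂ[Equiv.Perm α]}
    (hx : IsBiequivariant T x) {r : Equiv.Perm α} (hr : r ∈ rowPerms T) (g : Equiv.Perm α) :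
    x.coeff (r * g) = x.coeff g := by
  conv_lhs => rw [← hx.1 r hr]
  simp [MonoidAlgebra.coeff_single_mul_apply]

theorem IsBiequivariant.coeff_mul_right {T : α ≃ lam.cells} {x : ℂ[Equiv.Perm α]}
    (hx : IsBiequivariant T x) {q : Equiv.Perm α} (hq : q ∈ colPerms T) (g : Equiv.Perm α) :
    x.coeff (g * q) = ((Equiv.Perm.sign q : ℤ) : ℂ) * x.coeff g := by
  have h := congrArg (fun y => ((Equiv.Perm.sign q : ℤ) : ℂ) * y.coeff (g * q)) (hx.2 q hq)
  simp only [MonoidAlgebra.coeff_mul_single_apply, MonoidAlgebra.coeff_smul_apply, smul_eq_mul,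
    mul_one, mul_inv_cancel_right, ← mul_assoc, sign_mul_sign_self, one_mul] at h
  exact h.symm

/-- The coefficient vanishes at a permutation that maps two elements of a column into a row. -/
theorem IsBiequivariant.coeff_eq_zero {T : α ≃ lam.cells} {x : ℂ[Equiv.Perm α]}
    (hx : IsBiequivariant T x) (g : Equiv.Perm α) {a b : α} (hab : a ≠ b)
    (hrow : (T a).1.1 = (T b).1.1) (hcol : (T (g⁻¹ a)).1.2 = (T (g⁻¹ b)).1.2) :
    x.coeff g = 0 := by
  have h1 := hx.coeff_mul_left (swap_mem_rowPerms hrow) g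
  -- The row swap on the left of `g` is a column swap on its right, so the coefficient equals its
  -- negative.
  rw [Equiv.swap_mul_eq_mul_swap, hx.coeff_mul_right (swap_mem_colPerms hcol),
    Equiv.Perm.sign_swap (by simpa using hab)] at h1
  have h2 : -x.coeff g = x.coeff g := by simpa using h1
  exact self_eq_neg.1 h2.symm

theorem isBiequivariant_youngSymmetrizer (T : α ≃ lam.cells) :
    IsBiequivariant T (youngSymmetrizer T) :=
  ⟨fun _ hr => single_mul_youngSymmetrizer T hr, fun _ hq => youngSymmetrizer_mul_single T hq⟩

/-- By von Neumann's lemma every permutation is either a product $rq$, where the coefficient is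
$\operatorname{sgn}(q)$ times that at $1$, or has a collision, where it vanishes. The coefficient at
$1$ therefore determines the element. -/
theorem IsBiequivariant.eq_smul {T : α ≃ lam.cells} {x : ℂ[Equiv.Perm α]}
    (hx : IsBiequivariant T x) : x = x.coeff 1 • youngSymmetrizer T := by
  have hc := isBiequivariant_youngSymmetrizer T
  ext g
  rw [MonoidAlgebra.coeff_smul_apply, smul_eq_mul]
  rcases exists_eq_mul_or_exists_collision T g with ⟨r, hr, q, hq, rfl⟩ | ⟨a, b, hab, h1, h2⟩
  · have hr1 : ∀ y : ℂ[Equiv.Perm α], IsBiequivariant T y → y.coeff r = y.coeff 1 :=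
      fun y hy => by simpa using hy.coeff_mul_left hr 1
    rw [hx.coeff_mul_right hq, hc.coeff_mul_right hq, hr1 _ hx, hr1 _ hc,
      coeff_one_youngSymmetrizer]
    ring
  · rw [hx.coeff_eq_zero g hab h1 h2, hc.coeff_eq_zero g hab h1 h2, mul_zero]

theorem youngSymmetrizer_mul_mul_youngSymmetrizer (T : α ≃ lam.cells) (x : ℂ[Equiv.Perm α]) :
    youngSymmetrizer T * x * youngSymmetrizer T =
      (youngSymmetrizer T * x * youngSymmetrizer T).coeff 1 • youngSymmetrizer T := by
  refine IsBiequivariant.eq_smul ⟨fun r hr => ?_, fun q hq => ?_⟩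
  · rw [mul_assoc, ← mul_assoc, single_mul_youngSymmetrizer T hr]
  · rw [mul_assoc, youngSymmetrizer_mul_single T hq, mul_smul_comm]

/-- The coefficient at $1$ of a product is a symmetric bilinear form, nondegenerate by
`exists_coeff_one_mul_ne_zero`. It serves below to move factors around cyclically. -/
theorem coeff_one_mul_comm {G : Type*} [Group G] (x y : ℂ[G]) :
    (x * y).coeff 1 = (y * x).coeff 1 := by
  induction x using MonoidAlgebra.induction_linear with
  | zero => simp
  | add x z hx hz => simp [add_mul, mul_add, hx, hz]
  | single g r =>
    rw [MonoidAlgebra.coeff_single_mul_apply, MonoidAlgebra.coeff_mul_single_apply]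
    simp [mul_comm]

theorem trace_mulRight {G : Type*} [Group G] [Fintype G] (x : ℂ[G]) :
    LinearMap.trace ℂ ℂ[G] (LinearMap.mulRight ℂ x) = Fintype.card G * x.coeff 1 := by
  rw [LinearMap.trace_eq_matrix_trace ℂ (MonoidAlgebra.basis G ℂ), Matrix.trace]
  simp [LinearMap.toMatrix_apply, MonoidAlgebra.basis, MonoidAlgebra.coeff_single_mul_apply]

/-- If $c^2 = 0$, right multiplication by $c$ would be nilpotent, but its trace is the order of the
group, since $c$ has coefficient $1$ at the identity. -/
theorem youngSymmetrizer_mul_self_ne_zero (T : α ≃ lam.cells) :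
    youngSymmetrizer T * youngSymmetrizer T ≠ 0 := by
  intro h
  have hn : IsNilpotent (LinearMap.mulRight ℂ (youngSymmetrizer T)) := by
    refine ⟨2, ?_⟩
    refine LinearMap.ext fun x => ?_
    simp [pow_two, mul_assoc, h]
  have ht := (LinearMap.isNilpotent_trace_of_isNilpotent hn).eq_zero
  rw [trace_mulRight, coeff_one_youngSymmetrizer] at ht
  simp at ht

theorem exists_mul_self (T : α ≃ lam.cells) :
    ∃ k : ℂ, k ≠ 0 ∧ youngSymmetrizer T * youngSymmetrizer T = k • youngSymmetrizer T := by
  have h := youngSymmetrizer_mul_mul_youngSymmetrizer T 1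
  rw [mul_one] at h
  refine ⟨_, fun h0 => youngSymmetrizer_mul_self_ne_zero T ?_, h⟩
  rw [h, h0, zero_smul]

theorem exists_coeff_one_mul_ne_zero {G : Type*} [Group G] {x : ℂ[G]} (hx : x ≠ 0) :
    ∃ y : ℂ[G], (y * x).coeff 1 ≠ 0 := by
  obtain ⟨g, hg⟩ : ∃ g, x.coeff g ≠ 0 := by
    by_contra! h
    exact hx (by ext g; simp [h g])
  exact ⟨MonoidAlgebra.single g⁻¹ 1, by simpa [MonoidAlgebra.coeff_single_mul_apply] using hg⟩

/-- The left ideal of a Young symmetrizer is simple: a homomorphism that does not vanish on it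
is injective. -/
theorem mul_youngSymmetrizer_eq_zero (T : α ≃ lam.cells) {B : Type*} [Ring B] [Algebra ℂ B]
    (φ : ℂ[Equiv.Perm α] →ₐ[ℂ] B) {z : B} {u : ℂ[Equiv.Perm α]}
    (hz : φ (youngSymmetrizer T) * z ≠ 0) (hu : φ (u * youngSymmetrizer T) * z = 0) :
    u * youngSymmetrizer T = 0 := by
  by_contra hne
  obtain ⟨v, hv⟩ := exists_coeff_one_mul_ne_zero hne
  obtain ⟨k, hk, hkk⟩ := exists_mul_self T
  set c := youngSymmetrizer T
  -- The coefficient of $cvuc$ at $1$ is that of $vuc^2 = k\,vuc$. So $cvuc = mc$ with $m \ne 0$,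
  -- and $m\,\varphi(c)z = \varphi(cv)\,\varphi(uc)z = 0$.
  have h1 : c * (v * u) * c ≠ 0 := by
    intro h0
    have h2 : k * (v * (u * c)).coeff 1 = 0 := by
      rw [← smul_eq_mul, ← MonoidAlgebra.coeff_smul_apply, ← mul_smul_comm, ← mul_smul_comm,
        ← hkk, ← mul_assoc, ← mul_assoc, coeff_one_mul_comm, ← mul_assoc, h0]
      simp
    exact (mul_ne_zero hk hv) h2
  have h3 := youngSymmetrizer_mul_mul_youngSymmetrizer T (v * u)
  set m := (youngSymmetrizer T * (v * u) * youngSymmetrizer T).coeff 1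
  have hm : m ≠ 0 := fun h0 => h1 (by rw [h3, h0, zero_smul])
  have h4 : m • (φ c * z) = 0 := by
    rw [← smul_mul_assoc, ← map_smul, ← h3, show c * (v * u) * c = c * v * (u * c) by
      simp only [mul_assoc], map_mul, mul_assoc, hu, mul_zero]
  exact hz ((smul_eq_zero.1 h4).resolve_left hm)

end Symmetrizer

/-! ### The class sum of transpositions and its eigenvalue on a Specht module -/

section SwapSum

variable {α : Type*} [Fintype α] [DecidableEq α] {lam rho : YoungDiagram}

variable (α) in
/-- The sum of `swap a b` over all pairs `(a, b)`, a central element of the group algebra. -/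
def swapSum : ℂ[Equiv.Perm α] :=
  ∑ a : α, ∑ b : α, MonoidAlgebra.single (Equiv.swap a b) 1

theorem single_mul_swapSum (g : Equiv.Perm α) (r : ℂ) :
    MonoidAlgebra.single g r * swapSum α = swapSum α * MonoidAlgebra.single g r := by
  simp only [swapSum, Finset.mul_sum, Finset.sum_mul, MonoidAlgebra.single_mul_single]
  conv_rhs => rw [← Equiv.sum_comp g]
  refine Finset.sum_congr rfl fun a _ => ?_
  conv_rhs => rw [← Equiv.sum_comp g]
  refine Finset.sum_congr rfl fun b _ => ?_
  rw [Equiv.mul_swap_eq_swap_mul, mul_one, one_mul]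

theorem mul_swapSum (x : ℂ[Equiv.Perm α]) : x * swapSum α = swapSum α * x := by
  induction x using MonoidAlgebra.induction_linear with
  | zero => simp
  | add x y hx hy => rw [add_mul, mul_add, hx, hy]
  | single g r => exact single_mul_swapSum g r

/-- The coefficient of a Young symmetrizer at the transposition of two boxes. -/
def swapWeight (x y : ℕ × ℕ) : ℂ :=
  if x.1 = y.1 then 1 else if x.2 = y.2 then -1 else 0

theorem swapWeight_comm (x y : ℕ × ℕ) : swapWeight x y = swapWeight y x := by
  simp only [swapWeight, eq_comm]

theorem swapWeight_self (x : ℕ × ℕ) : swapWeight x x = 1 := by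
  simp [swapWeight]

/-- The sum of `swapWeight` over all pairs of boxes, the number of boxes plus twice the sum of
the contents. -/
def swapEigenvalue (lam : YoungDiagram) : ℂ :=
  ∑ x ∈ lam.cells, ∑ y ∈ lam.cells, swapWeight x y

/-- The element `d` in the row of `a` and the column of `b` collides with `a`: the two share a row,
and the transposition puts `a` into the column of `d`. -/
theorem coeff_swap_of_lt (T : α ≃ lam.cells) {a b : α} (h1 : (T a).1.1 < (T b).1.1)
    (h2 : (T a).1.2 ≠ (T b).1.2) :
    (youngSymmetrizer T).coeff (Equiv.swap a b) = 0 := by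
  have hmem : ((T a).1.1, (T b).1.2) ∈ lam.cells :=
    (YoungDiagram.mem_cells _).2 (lam.up_left_mem h1.le le_rfl ((YoungDiagram.mem_cells _).1 (T b).2))
  set d := T.symm ⟨_, hmem⟩ with hd
  have hTd : (T d).1 = ((T a).1.1, (T b).1.2) := by rw [hd, T.apply_symm_apply]
  have hda : d ≠ a := fun h => h2 (by rw [← h, hTd])
  have hdb : d ≠ b := fun h => h1.ne (by rw [← h, hTd])
  refine (isBiequivariant_youngSymmetrizer T).coeff_eq_zero _ hda (by rw [hTd]) ?_
  rw [Equiv.swap_inv, Equiv.swap_apply_left, Equiv.swap_apply_of_ne_of_ne hda hdb, hTd]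

theorem coeff_swap (T : α ≃ lam.cells) (a b : α) :
    (youngSymmetrizer T).coeff (Equiv.swap a b) = swapWeight (T a).1 (T b).1 := by
  have hc := isBiequivariant_youngSymmetrizer T
  unfold swapWeight
  split_ifs with h1 h2
  · simpa [coeff_one_youngSymmetrizer] using hc.coeff_mul_left (swap_mem_rowPerms h1) 1
  · have hab : a ≠ b := fun h => h1 (by rw [h])
    simpa [coeff_one_youngSymmetrizer, Equiv.Perm.sign_swap hab] using
      hc.coeff_mul_right (swap_mem_colPerms h2) 1
  · rcases lt_or_gt_of_ne h1 with h | h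
    · exact coeff_swap_of_lt T h h2
    · rw [Equiv.swap_comm]
      exact coeff_swap_of_lt T h (Ne.symm h2)

/-- Multiplying by a central element preserves biequivariance, so the product is a multiple of the
symmetrizer. The factor is its coefficient at $1$, the sum of the coefficients of the symmetrizer at
all swaps. -/
theorem swapSum_mul_youngSymmetrizer (T : α ≃ lam.cells) :
    swapSum α * youngSymmetrizer T = swapEigenvalue lam • youngSymmetrizer T := by
  have h : IsBiequivariant T (swapSum α * youngSymmetrizer T) := by
    refine ⟨fun r hr => ?_, fun q hq => ?_⟩
    · rw [← mul_assoc, mul_swapSum, mul_assoc, single_mul_youngSymmetrizer T hr]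
    · rw [mul_assoc, youngSymmetrizer_mul_single T hq, mul_smul_comm]
  rw [h.eq_smul]
  congr 1
  simp only [swapSum, Finset.sum_mul, MonoidAlgebra.coeff_sum, Finsupp.finsetSum_apply,
    MonoidAlgebra.coeff_single_mul_apply, Equiv.swap_inv, mul_one, one_mul, coeff_swap]
  rw [swapEigenvalue, ← Finset.sum_coe_sort lam.cells, ← T.sum_comp]
  refine Finset.sum_congr rfl fun a _ => ?_
  rw [← Finset.sum_coe_sort lam.cells, ← T.sum_comp]

end SwapSum

/-! ### Adding one box: contents and eigenvalues -/

section Covers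

variable {lam rho sigma : YoungDiagram}

/-- `lam` arises from `rho` by adding one box. -/
def IsCover (rho lam : YoungDiagram) : Prop :=
  rho ≤ lam ∧ lam.card = rho.card + 1

theorem IsCover.exists_insert (h : IsCover rho lam) :
    ∃ x, x ∉ rho.cells ∧ lam.cells = insert x rho.cells := by
  have hs := YoungDiagram.cells_subset_iff.2 h.1
  have hc : (lam.cells \ rho.cells).card = 1 := by
    rw [Finset.card_sdiff_of_subset hs]
    have := h.2
    simp only [YoungDiagram.card] at this
    omega
  obtain ⟨x, hx⟩ := Finset.card_eq_one.1 hc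
  have hxm : x ∈ lam.cells \ rho.cells := by simp [hx]
  refine ⟨x, (Finset.mem_sdiff.1 hxm).2, ?_⟩
  rw [← Finset.sdiff_union_of_subset hs, hx]
  rfl

/-- The box of a diagram that is not in the smaller diagram. -/
def IsCover.box (h : IsCover rho lam) : ℕ × ℕ := h.exists_insert.choose

theorem IsCover.box_notMem (h : IsCover rho lam) : h.box ∉ rho.cells :=
  h.exists_insert.choose_spec.1

theorem IsCover.cells_eq (h : IsCover rho lam) : lam.cells = insert h.box rho.cells :=
  h.exists_insert.choose_spec.2

theorem isCover_of_cells_eq {x : ℕ × ℕ} (hx : x ∉ rho.cells)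
    (h : lam.cells = insert x rho.cells) : IsCover rho lam := by
  refine ⟨YoungDiagram.cells_subset_iff.1 (h ▸ Finset.subset_insert _ _), ?_⟩
  rw [YoungDiagram.card, h, Finset.card_insert_of_notMem hx]

theorem IsCover.box_eq (h : IsCover rho lam) {x : ℕ × ℕ} (hx : x ∉ rho.cells)
    (hl : x ∈ lam.cells) : h.box = x := by
  rw [h.cells_eq, Finset.mem_insert] at hl
  exact (hl.resolve_right hx).symm

/-- Boxes strictly before the box that is added are in the smaller diagram. -/
theorem IsCover.mem_of_le (h : IsCover rho lam) {x : ℕ × ℕ} (h1 : x.1 ≤ h.box.1)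
    (h2 : x.2 ≤ h.box.2) (hne : x ≠ h.box) : x ∈ rho.cells := by
  have hb : h.box ∈ lam.cells := by rw [h.cells_eq]; exact Finset.mem_insert_self _ _
  have : x ∈ lam.cells :=
    (YoungDiagram.mem_cells _).2 (lam.up_left_mem h1 h2 ((YoungDiagram.mem_cells _).1 hb))
  rw [h.cells_eq, Finset.mem_insert] at this
  exact this.resolve_left hne

/-- The box that is added is minimal among the boxes that are not in the smaller diagram. -/
theorem IsCover.not_le_box (h : IsCover rho lam) {x : ℕ × ℕ} (hx : x ∈ rho.cells) :
    ¬ (h.box.1 ≤ x.1 ∧ h.box.2 ≤ x.2) := fun hle =>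
  h.box_notMem ((YoungDiagram.mem_cells _).2
    (rho.up_left_mem hle.1 hle.2 ((YoungDiagram.mem_cells _).1 hx)))

/-- The content of a box: its column minus its row. -/
def content (x : ℕ × ℕ) : ℤ := x.2 - x.1

/-- To the left of the new box lie as many boxes as its column index, each of weight $1$; above it
lie as many as its row index, each of weight $-1$. -/
theorem IsCover.sum_swapWeight (h : IsCover rho lam) :
    ∑ y ∈ rho.cells, swapWeight h.box y = content h.box := by
  have hrow : (rho.cells.filter fun y => h.box.1 = y.1).card = h.box.2 := by
    rw [← Finset.card_range h.box.2]
    refine Finset.card_nbij' (fun y => y.2) (fun j => (h.box.1, j)) ?_ ?_ ?_ ?_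
    · intro y hy
      have hy := Finset.mem_filter.1 hy
      have := h.not_le_box hy.1
      simp only [Finset.coe_range, Set.mem_Iio]
      have := hy.2
      omega
    · intro j hj
      have hj : j < h.box.2 := by simpa using hj
      have := h.mem_of_le (x := (h.box.1, j)) le_rfl hj.le (fun e => hj.ne (by rw [← e]))
      simpa using this
    · intro y hy
      have hy := Finset.mem_filter.1 hy
      simp [hy.2]
    · exact fun _ _ => rfl
  have hcol : (rho.cells.filter fun y => h.box.2 = y.2).card = h.box.1 := by
    rw [← Finset.card_range h.box.1]
    refine Finset.card_nbij' (fun y => y.1) (fun i => (i, h.box.2)) ?_ ?_ ?_ ?_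
    · intro y hy
      have hy := Finset.mem_filter.1 hy
      have := h.not_le_box hy.1
      simp only [Finset.coe_range, Set.mem_Iio]
      have := hy.2
      omega
    · intro j hj
      have hj : j < h.box.1 := by simpa using hj
      have := h.mem_of_le (x := (j, h.box.2)) hj.le le_rfl (fun e => hj.ne (by rw [← e]))
      simpa using this
    · intro y hy
      have hy := Finset.mem_filter.1 hy
      simp [hy.2]
    · exact fun _ _ => rfl
  have hw : ∀ y ∈ rho.cells, swapWeight h.box y =
      (if h.box.1 = y.1 then 1 else 0) - (if h.box.2 = y.2 then 1 else 0) := by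
    intro y hy
    have := h.not_le_box hy
    unfold swapWeight
    split_ifs <;> first | omega | simp
  rw [Finset.sum_congr rfl hw, Finset.sum_sub_distrib, ← Finset.sum_filter,
    ← Finset.sum_filter, Finset.sum_const, Finset.sum_const, hrow, hcol]
  simp [content]

theorem IsCover.swapEigenvalue_eq (h : IsCover rho lam) :
    swapEigenvalue lam = swapEigenvalue rho + 1 + 2 * content h.box := by
  rw [swapEigenvalue, h.cells_eq, Finset.sum_insert h.box_notMem,
    Finset.sum_insert h.box_notMem]
  have h2 : ∀ x ∈ rho.cells, ∑ y ∈ insert h.box rho.cells, swapWeight x y =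
      swapWeight h.box x + ∑ y ∈ rho.cells, swapWeight x y := fun x _ => by
    rw [Finset.sum_insert h.box_notMem, swapWeight_comm]
  rw [Finset.sum_congr rfl h2, Finset.sum_add_distrib, h.sum_swapWeight, swapWeight_self,
    swapEigenvalue]
  ring

/-- Boxes of equal content lie on one diagonal and are comparable, whereas two distinct addable
boxes are not. Together with `ext_lower` this makes the eigenvalues that separate the covers
distinct. -/
theorem IsCover.ext_upper {lam' : YoungDiagram} (h : IsCover rho lam) (h' : IsCover rho lam')
    (hc : content h.box = content h'.box) : lam = lam' := by
  have hb : h.box = h'.box := by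
    by_contra hne
    simp only [content] at hc
    rcases le_total h.box.1 h'.box.1 with hle | hle
    · exact h.box_notMem (h'.mem_of_le hle (by omega) hne)
    · exact h'.box_notMem (h.mem_of_le hle (by omega) (Ne.symm hne))
  exact YoungDiagram.ext (by rw [h.cells_eq, h'.cells_eq, hb])

theorem IsCover.ext_lower {rho' : YoungDiagram} (h : IsCover rho lam) (h' : IsCover rho' lam)
    (hc : content h.box = content h'.box) : rho = rho' := by
  have hb : h.box = h'.box := by
    by_contra hne
    have h1 : h.box ∈ lam.cells := by rw [h.cells_eq]; exact Finset.mem_insert_self _ _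
    have h2 : h'.box ∈ lam.cells := by rw [h'.cells_eq]; exact Finset.mem_insert_self _ _
    rw [h'.cells_eq, Finset.mem_insert] at h1
    rw [h.cells_eq, Finset.mem_insert] at h2
    have h1 := h1.resolve_left hne
    have h2 := h2.resolve_left (Ne.symm hne)
    have h3 := h.not_le_box h2
    have h4 := h'.not_le_box h1
    simp only [content] at hc
    omega
  refine YoungDiagram.ext ?_
  rw [← Finset.erase_insert h.box_notMem, ← h.cells_eq, h'.cells_eq, hb,
    Finset.erase_insert h'.box_notMem]

end Covers

/-! ### Independence of the filling, and traces on Specht modules -/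

section Relabel

variable {α α' : Type*} [Fintype α] [DecidableEq α] [Fintype α'] [DecidableEq α']
  {lam : YoungDiagram}

/-- The left ideal that is generated by the Young symmetrizer of `T`. -/
abbrev specht (T : α ≃ lam.cells) : Submodule ℂ ℂ[Equiv.Perm α] :=
  (spechtModule T).toSubmodule

theorem mem_specht {T : α ≃ lam.cells} {x : ℂ[Equiv.Perm α]} :
    x ∈ specht T ↔ ∃ u, u * youngSymmetrizer T = x := Iff.rfl

theorem mul_mem_specht {T : α ≃ lam.cells} (u : ℂ[Equiv.Perm α]) {x : ℂ[Equiv.Perm α]}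
    (hx : x ∈ specht T) : u * x ∈ specht T := by
  obtain ⟨v, rfl⟩ := mem_specht.1 hx
  exact mem_specht.2 ⟨u * v, mul_assoc _ _ _⟩

/-- The action of the group algebra on a Specht module. -/
def leftAct (T : α ≃ lam.cells) (u : ℂ[Equiv.Perm α]) : Module.End ℂ (specht T) :=
  (LinearMap.mulLeft ℂ u).restrict fun _ hx => mul_mem_specht u hx

@[simp]
theorem coe_leftAct (T : α ≃ lam.cells) (u : ℂ[Equiv.Perm α]) (x : specht T) :
    (leftAct T u x : ℂ[Equiv.Perm α]) = u * x := rfl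

theorem leftAct_mul (T : α ≃ lam.cells) (u v : ℂ[Equiv.Perm α]) :
    leftAct T (u * v) = leftAct T u ∘ₗ leftAct T v := by
  ext x : 2
  simp [mul_assoc]

theorem leftAct_add (T : α ≃ lam.cells) (u v : ℂ[Equiv.Perm α]) :
    leftAct T (u + v) = leftAct T u + leftAct T v := by
  ext x : 2
  simp [add_mul]

theorem leftAct_one (T : α ≃ lam.cells) : leftAct T 1 = LinearMap.id := by
  ext x : 2
  simp

/-- The trace of the action of an element of the group algebra on a Specht module. -/
def spechtTrace (T : α ≃ lam.cells) (u : ℂ[Equiv.Perm α]) : ℂ :=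
  LinearMap.trace ℂ (specht T) (leftAct T u)

theorem character_irrep (lam : YoungDiagram) (g : Equiv.Perm (Fin lam.card)) :
    (irrep lam).character g = spechtTrace (tableau lam) (MonoidAlgebra.single g 1) := by
  rw [Representation.character, spechtTrace]
  congr 1
  ext x : 2
  exact leftRegular_apply g x.1

/-- The isomorphism of group algebras that is induced by a bijection. -/
def relabel (e : α ≃ α') : ℂ[Equiv.Perm α] ≃ₐ[ℂ] ℂ[Equiv.Perm α'] :=
  MonoidAlgebra.domCongr ℂ ℂ e.permCongrHom

@[simp]
theorem relabel_single (e : α ≃ α') (g : Equiv.Perm α) (r : ℂ) :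
    relabel e (MonoidAlgebra.single g r) = MonoidAlgebra.single (e.permCongr g) r := by
  simp [relabel]

theorem relabel_youngSymmetrizer (T : α ≃ lam.cells) (T' : α' ≃ lam.cells) :
    relabel (T.trans T'.symm) (youngSymmetrizer T) = youngSymmetrizer T' := by
  have hT : ∀ a, T' ((T.trans T'.symm) a) = T a := by simp
  rw [youngSymmetrizer, youngSymmetrizer, map_mul, map_sum, map_sum]
  set e := T.trans T'.symm
  congr 1
  · refine Finset.sum_equiv e.permCongr (fun g => ?_) fun g _ => by simp
    rw [mem_rowPerms, mem_rowPerms, ← e.forall_congr_right]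
    simp [Equiv.permCongr_apply, hT]
  · refine Finset.sum_equiv e.permCongr (fun g => ?_) fun g _ => by simp
    rw [mem_colPerms, mem_colPerms, ← e.forall_congr_right]
    simp [Equiv.permCongr_apply, hT]

/-- The Specht modules of two fillings of the same diagram are isomorphic. -/
def spechtEquiv (T : α ≃ lam.cells) (T' : α' ≃ lam.cells) : specht T ≃ₗ[ℂ] specht T' :=
  (relabel (T.trans T'.symm)).toLinearEquiv.submoduleMap (specht T) |>.trans <|
    LinearEquiv.ofEq _ _ <| by
      ext x
      rw [Submodule.mem_map]
      constructor
      · rintro ⟨y, hy, rfl⟩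
        obtain ⟨u, rfl⟩ := mem_specht.1 hy
        exact mem_specht.2 ⟨relabel (T.trans T'.symm) u, by
          rw [← relabel_youngSymmetrizer T T', ← map_mul]; rfl⟩
      · intro hx
        obtain ⟨u, rfl⟩ := mem_specht.1 hx
        refine ⟨(relabel (T.trans T'.symm)).symm u * youngSymmetrizer T,
          mem_specht.2 ⟨_, rfl⟩, ?_⟩
        rw [← relabel_youngSymmetrizer T T']
        simp

@[simp]
theorem coe_spechtEquiv (T : α ≃ lam.cells) (T' : α' ≃ lam.cells) (x : specht T) :
    (spechtEquiv T T' x : ℂ[Equiv.Perm α']) = relabel (T.trans T'.symm) x := rfl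

theorem finrank_specht (T : α ≃ lam.cells) : Module.finrank ℂ (specht T) = dim lam :=
  (spechtEquiv T (tableau lam)).finrank_eq

theorem spechtTrace_relabel (T : α ≃ lam.cells) (T' : α' ≃ lam.cells) (u : ℂ[Equiv.Perm α]) :
    spechtTrace T' (relabel (T.trans T'.symm) u) = spechtTrace T u := by
  rw [spechtTrace, spechtTrace, ← LinearMap.trace_conj' (leftAct T u) (spechtEquiv T T')]
  congr 1
  ext x : 2
  obtain ⟨y, rfl⟩ := (spechtEquiv T T').surjective x
  simp [LinearEquiv.conj_apply]

theorem cycleType_permCongr (e : α ≃ α') (g : Equiv.Perm α) :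
    (e.permCongr g).cycleType = g.cycleType := by
  have h : e.permCongr g =
      g.extendDomain (e.trans (Equiv.subtypeUnivEquiv fun _ : α' => trivial).symm) := by
    ext x
    obtain ⟨a, rfl⟩ := e.surjective x
    have := g.extendDomain_apply_image
      (e.trans (Equiv.subtypeUnivEquiv fun _ : α' => trivial).symm) a
    simpa [Equiv.permCongr_apply] using this.symm
  rw [h, Equiv.Perm.cycleType_extendDomain]

theorem charInvolution_eq_spechtTrace (T : α ≃ lam.cells) {s : ℕ} {g : Equiv.Perm α}
    (hg : g.cycleType = Multiset.replicate s 2) :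
    charInvolution lam s = spechtTrace T (MonoidAlgebra.single g 1) := by
  rw [← spechtTrace_relabel T (tableau lam), relabel_single, ← character_irrep]
  exact charInvolution_eq lam s _ (by rw [cycleType_permCongr, hg])

theorem dim_ne_zero (lam : YoungDiagram) : dim lam ≠ 0 := by
  have hne : youngSymmetrizer (tableau lam) ≠ 0 := fun h => by
    simpa [h] using coeff_one_youngSymmetrizer (tableau lam)
  have : Nontrivial (specht (tableau lam)) :=
    ⟨⟨⟨_, mem_specht.2 ⟨1, one_mul _⟩⟩, 0, fun h => hne (congrArg Subtype.val h)⟩⟩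
  exact (Module.finrank_pos (R := ℂ) (M := specht (tableau lam))).ne'

/-- Relabelling along a permutation of the same set is conjugation by it. -/
theorem relabel_mul_single (e : Equiv.Perm α) (x : ℂ[Equiv.Perm α]) :
    relabel e x * MonoidAlgebra.single e 1 = MonoidAlgebra.single e 1 * x := by
  induction x using MonoidAlgebra.induction_linear with
  | zero => simp
  | add x y hx hy => rw [map_add, add_mul, mul_add, hx, hy]
  | single g r =>
    rw [relabel_single, MonoidAlgebra.single_mul_single, MonoidAlgebra.single_mul_single,
      mul_one, one_mul]
    congr 1
    ext a
    simp

end Relabel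

/-! ### One more point: Jucys–Murphy element and nonzero products of symmetrizers -/

section Embedding

variable {β : Type*} [Fintype β] [DecidableEq β] {lam rho : YoungDiagram}

variable (β) in
/-- The embedding of the permutations of `β` as the permutations of `Option β` that fix `none`. -/
def optionHom : Equiv.Perm β →* Equiv.Perm (Option β) where
  toFun := Equiv.optionCongr
  map_one' := Equiv.optionCongr_one
  map_mul' g h := by
    ext (_ | a) <;> simp

@[simp]
theorem optionHom_apply (g : Equiv.Perm β) : optionHom β g = Equiv.optionCongr g := rfl

/-- The induced embedding of group algebras. -/
def incl : ℂ[Equiv.Perm β] →ₐ[ℂ] ℂ[Equiv.Perm (Option β)] :=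
  MonoidAlgebra.mapDomainAlgHom ℂ ℂ (optionHom β)

@[simp]
theorem incl_single (g : Equiv.Perm β) (r : ℂ) :
    incl (MonoidAlgebra.single g r) = MonoidAlgebra.single (Equiv.optionCongr g) r := by
  simp [incl]

variable (β) in
/-- The Jucys–Murphy element of `none`. -/
def jucysMurphy : ℂ[Equiv.Perm (Option β)] :=
  ∑ b : β, MonoidAlgebra.single (Equiv.swap none (some b)) 1

/-- Up to constants, the Jucys–Murphy element is half the difference of the class sums of the larger
and the smaller group; this yields its eigenvalues. -/
theorem swapSum_option :
    swapSum (Option β) = incl (swapSum β) + 2 * jucysMurphy β + 1 := by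
  simp only [swapSum, Fintype.sum_option, Equiv.swap_self, map_sum, incl_single,
    Equiv.optionCongr_swap, Finset.sum_add_distrib]
  rw [show MonoidAlgebra.single (Equiv.refl (Option β)) (1 : ℂ) = 1 from rfl]
  simp only [Equiv.swap_comm (some _) none]
  rw [jucysMurphy, two_mul]
  abel

/-- A filling of `rho` extends to a filling of a diagram with one more box. -/
def extendFilling (h : IsCover rho lam) (T : β ≃ rho.cells) : Option β ≃ lam.cells :=
  Equiv.ofBijective
    (fun o => o.elim ⟨h.box, by rw [h.cells_eq]; exact Finset.mem_insert_self _ _⟩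
      fun b => ⟨(T b).1, by rw [h.cells_eq]; exact Finset.mem_insert_of_mem (T b).2⟩) <| by
    constructor
    · rintro (_ | a) (_ | b) hab
      · rfl
      · exact absurd (congrArg Subtype.val hab) fun e : h.box = (T b).1 => h.box_notMem (e ▸ (T b).2)
      · exact absurd (congrArg Subtype.val hab) fun e : (T a).1 = h.box => h.box_notMem (e ▸ (T a).2)
      · have := congrArg Subtype.val hab
        exact congrArg some (T.injective (Subtype.ext this))
    · rintro ⟨x, hx⟩
      have hx' := hx
      rw [h.cells_eq, Finset.mem_insert] at hx'
      rcases hx' with rfl | hx'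
      · exact ⟨none, rfl⟩
      · exact ⟨some (T.symm ⟨x, hx'⟩), Subtype.ext (by simp)⟩

theorem extendFilling_some (h : IsCover rho lam) (T : β ≃ rho.cells) (b : β) :
    (extendFilling h T (some b)).1 = (T b).1 := rfl

theorem optionCongr_mem_rowPerms (h : IsCover rho lam) {T : β ≃ rho.cells} {g : Equiv.Perm β}
    (hg : g ∈ rowPerms T) : Equiv.optionCongr g ∈ rowPerms (extendFilling h T) := by
  rw [mem_rowPerms] at *
  rintro (_ | a)
  · rfl
  · simpa [extendFilling_some] using hg a

theorem optionCongr_mem_colPerms (h : IsCover rho lam) {T : β ≃ rho.cells} {g : Equiv.Perm β}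
    (hg : g ∈ colPerms T) : Equiv.optionCongr g ∈ colPerms (extendFilling h T) := by
  rw [mem_colPerms] at *
  rintro (_ | a)
  · rfl
  · simpa [extendFilling_some] using hg a

theorem incl_rowSum_mul_rowSum (h : IsCover rho lam) (T : β ≃ rho.cells) :
    incl (rowSum T) * rowSum (extendFilling h T) =
      ((rowPerms T).card : ℂ) • rowSum (extendFilling h T) := by
  rw [show incl (rowSum T) = ∑ g ∈ rowPerms T, MonoidAlgebra.single (Equiv.optionCongr g) 1 by
    simp [rowSum], Finset.sum_mul,
    Finset.sum_congr rfl fun g hg => single_mul_rowSum _ (optionCongr_mem_rowPerms h hg)]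
  simp [← Nat.cast_smul_eq_nsmul ℂ]

theorem colSum_mul_incl_colSum (h : IsCover rho lam) (T : β ≃ rho.cells) :
    colSum (extendFilling h T) * incl (colSum T) =
      ((colPerms T).card : ℂ) • colSum (extendFilling h T) := by
  have h1 : incl (colSum T) = ∑ g ∈ colPerms T,
      ((Equiv.Perm.sign g : ℤ) : ℂ) • MonoidAlgebra.single (Equiv.optionCongr g) (1 : ℂ) := by
    simp [colSum]
  have h2 : ∀ g ∈ colPerms T, colSum (extendFilling h T) *
      (((Equiv.Perm.sign g : ℤ) : ℂ) • MonoidAlgebra.single (Equiv.optionCongr g) (1 : ℂ)) =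
      colSum (extendFilling h T) := fun g hg => by
    rw [mul_smul_comm, colSum_mul_single _ (optionCongr_mem_colPerms h hg),
      Equiv.optionCongr_sign, smul_smul, sign_mul_sign_self, one_smul]
  rw [h1, Finset.mul_sum, Finset.sum_congr rfl h2]
  simp [← Nat.cast_smul_eq_nsmul ℂ]

theorem isBiequivariant_rowSum_mul_mul_colSum (T : β ≃ rho.cells) (y : ℂ[Equiv.Perm β]) :
    IsBiequivariant T (rowSum T * y * colSum T) := by
  refine ⟨fun r hr => ?_, fun q hq => ?_⟩
  · rw [← mul_assoc, ← mul_assoc, single_mul_rowSum T hr]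
  · rw [mul_assoc, colSum_mul_single T hq, mul_smul_comm]

/-- Write $a$, $b$ for the row and column sums, $c = ab$. Each $ayb$ is a multiple of $c$, so
pairing $y$ with $b(ab)a$ under the coefficient form gives $k$ times its pairing with $ba$.
Nondegeneracy finishes. -/
theorem colSum_mul_rowSum_mul_self (T : β ≃ rho.cells) {k : ℂ}
    (hk : youngSymmetrizer T * youngSymmetrizer T = k • youngSymmetrizer T) :
    colSum T * rowSum T * (colSum T * rowSum T) = k • (colSum T * rowSum T) := by
  by_contra hne
  obtain ⟨y, hy⟩ := exists_coeff_one_mul_ne_zero (sub_ne_zero.2 hne)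
  refine hy ?_
  have h1 : ∀ z : ℂ[Equiv.Perm β], (y * (colSum T * z * rowSum T)).coeff 1 =
      (rowSum T * y * colSum T * z).coeff 1 := fun z => by
    rw [← mul_assoc, ← mul_assoc, coeff_one_mul_comm, ← mul_assoc, ← mul_assoc]
  have h2 := (isBiequivariant_rowSum_mul_mul_colSum T y).eq_smul
  have h3 := h1 (rowSum T * colSum T)
  rw [h2, ← youngSymmetrizer_eq, smul_mul_assoc, hk] at h3
  have h4 := h1 1
  rw [mul_one, mul_one] at h4
  rw [mul_sub, MonoidAlgebra.coeff_sub, Finsupp.sub_apply, mul_smul_comm,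
    MonoidAlgebra.coeff_smul_apply, h4, sub_eq_zero,
    show colSum T * rowSum T * (colSum T * rowSum T) =
      colSum T * youngSymmetrizer T * rowSum T by simp only [youngSymmetrizer_eq, mul_assoc], h3]
  simp [coeff_one_youngSymmetrizer, mul_comm]

/-- With primes for the extended filling, $b'b$ is a nonzero multiple of $b'$. If $a'b'ab = 0$,
inserting $b$ after $b'$ and using $(ba)^2 = k\,ba$ yields $a'b'a = 0$. But the coefficient of
$a'b'a$ at $1$ is that of $aa'b'$, the number of row permutations. -/
theorem youngSymmetrizer_mul_incl_ne_zero (h : IsCover rho lam) (T : β ≃ rho.cells) :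
    youngSymmetrizer (extendFilling h T) * incl (youngSymmetrizer T) ≠ 0 := by
  intro h0
  obtain ⟨k, hk, hkk⟩ := exists_mul_self T
  have h1 := congrArg (incl (β := β)) (colSum_mul_rowSum_mul_self T hkk)
  set a := incl (rowSum T) with ha
  set b := incl (colSum T) with hb
  set a' := rowSum (extendFilling h T) with ha'
  set b' := colSum (extendFilling h T) with hb'
  simp only [map_mul, map_smul, ← ha, ← hb] at h1
  have hbb : b' * b = ((colPerms T).card : ℂ) • b' := colSum_mul_incl_colSum h T
  have haa : a * a' = ((rowPerms T).card : ℂ) • a' := incl_rowSum_mul_rowSum h T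
  have h2 : a' * b' * (a * b) = 0 := by
    rw [← h0, youngSymmetrizer_eq, youngSymmetrizer_eq, map_mul]
  have h3 : ((colPerms T).card : ℂ) • (a' * b' * (a * b) * a) =
      (k * (colPerms T).card) • (a' * b' * a) := by
    calc ((colPerms T).card : ℂ) • (a' * b' * (a * b) * a)
        = a' * (((colPerms T).card : ℂ) • b') * (a * b) * a := by
          simp only [smul_mul_assoc, mul_smul_comm]
      _ = a' * b' * (b * a * (b * a)) := by rw [← hbb]; simp only [mul_assoc]
      _ = k • (a' * (b' * b) * a) := by rw [h1]; simp only [mul_assoc, mul_smul_comm]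
      _ = _ := by rw [hbb]; simp only [smul_mul_assoc, mul_smul_comm, smul_smul]
  rw [h2, zero_mul, smul_zero] at h3
  have h4 : a' * b' * a = 0 :=
    (smul_eq_zero.1 h3.symm).resolve_left (mul_ne_zero hk (card_colPerms_ne_zero T))
  have h5 : (a' * b' * a).coeff 1 = (rowPerms T).card := by
    rw [coeff_one_mul_comm, ← mul_assoc, haa, smul_mul_assoc, MonoidAlgebra.coeff_smul_apply,
      ← youngSymmetrizer_eq, coeff_one_youngSymmetrizer, smul_eq_mul, mul_one]
  rw [h4] at h5
  exact card_rowPerms_ne_zero T h5.symm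

theorem exists_youngSymmetrizer_mul_incl_ne_zero (h : IsCover rho lam) (T : β ≃ rho.cells)
    (T' : Option β ≃ lam.cells) :
    ∃ x, youngSymmetrizer T' * (x * incl (youngSymmetrizer T)) ≠ 0 := by
  set e := (extendFilling h T).trans T'.symm with he
  refine ⟨MonoidAlgebra.single e 1, fun h0 => youngSymmetrizer_mul_incl_ne_zero h T ?_⟩
  rw [← relabel_youngSymmetrizer (extendFilling h T) T', ← he, ← mul_assoc, relabel_mul_single,
    mul_assoc] at h0
  have := congrArg (MonoidAlgebra.single e⁻¹ (1 : ℂ) * ·) h0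
  simpa [← mul_assoc, MonoidAlgebra.single_mul_single, ← MonoidAlgebra.one_def] using this

theorem exists_incl_mul_youngSymmetrizer_ne_zero (h : IsCover rho lam) (T : β ≃ rho.cells)
    (T' : Option β ≃ lam.cells) :
    ∃ x, incl (youngSymmetrizer T) * (x * youngSymmetrizer T') ≠ 0 := by
  obtain ⟨x, hx⟩ := exists_youngSymmetrizer_mul_incl_ne_zero h T T'
  obtain ⟨y, hy⟩ := exists_coeff_one_mul_ne_zero hx
  refine ⟨y, fun h0 => hy ?_⟩
  rw [← mul_assoc, ← mul_assoc, coeff_one_mul_comm,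
    show incl (youngSymmetrizer T) * (y * youngSymmetrizer T' * x) =
      incl (youngSymmetrizer T) * (y * youngSymmetrizer T') * x by simp only [mul_assoc], h0]
  simp

end Embedding

/-! ### Young's lattice and the counting argument for the branching rule -/

section YoungLattice

variable {lam rho rho' sigma : YoungDiagram}

/-- The diagrams that arise from `lam` by removing one box. -/
def lowerCovers (lam : YoungDiagram) : Finset YoungDiagram :=
  (subdiagrams lam).filter (IsCover · lam)

theorem mem_subdiagrams : rho ∈ subdiagrams lam ↔ rho ≤ lam := by
  simp [subdiagrams]

theorem mem_lowerCovers : rho ∈ lowerCovers lam ↔ IsCover rho lam := by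
  simp only [lowerCovers, Finset.mem_filter, mem_subdiagrams, and_iff_right_iff_imp]
  exact fun h => h.1

theorem IsCover.box_le (h : IsCover rho lam) : h.box.1 ≤ rho.card ∧ h.box.2 ≤ rho.card := by
  constructor
  · rw [← Finset.card_range h.box.1]
    refine Finset.card_le_card_of_injOn (fun i => (i, h.box.2)) (fun i hi => ?_)
      fun i _ j _ hij => congrArg Prod.fst hij
    have hi : i < h.box.1 := by simpa using hi
    exact h.mem_of_le (x := (i, h.box.2)) hi.le le_rfl fun e => hi.ne (by rw [← e])
  · rw [← Finset.card_range h.box.2]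
    refine Finset.card_le_card_of_injOn (fun i => (h.box.1, i)) (fun i hi => ?_)
      fun i _ j _ hij => congrArg Prod.snd hij
    have hi : i < h.box.2 := by simpa using hi
    exact h.mem_of_le (x := (h.box.1, i)) le_rfl hi.le fun e => hi.ne (by rw [← e])

theorem finite_upperCovers (rho : YoungDiagram) : {lam | IsCover rho lam}.Finite := by
  refine Set.Finite.of_finite_image (f := YoungDiagram.cells)
    (((Finset.range (rho.card + 1) ×ˢ Finset.range (rho.card + 1)).image
      fun x => insert x rho.cells).finite_toSet.subset ?_) fun a _ b _ h => YoungDiagram.ext h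
  rintro _ ⟨lam, h, rfl⟩
  have h : IsCover rho lam := h
  have hb := h.box_le
  rw [h.cells_eq]
  exact Finset.mem_coe.2 (Finset.mem_image_of_mem _ (by
    simp only [Finset.mem_product, Finset.mem_range]
    omega))

/-- The diagrams that arise from `rho` by adding one box. -/
def upperCovers (rho : YoungDiagram) : Finset YoungDiagram :=
  (finite_upperCovers rho).toFinset

theorem mem_upperCovers : lam ∈ upperCovers rho ↔ IsCover rho lam := by
  simp [upperCovers]

theorem exists_isCover_of_card_pos (h : 0 < lam.card) : ∃ rho, IsCover rho lam := by
  obtain ⟨x, hx⟩ := Finset.exists_maximal (Finset.card_pos.1 h)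
  let rho : YoungDiagram := ⟨lam.cells.erase x, fun a b hba ha => by
    simp only [Finset.coe_erase, Set.mem_sdiff, Finset.mem_coe, Set.mem_singleton_iff] at ha ⊢
    refine ⟨lam.isLowerSet hba ha.1, ?_⟩
    rintro rfl
    exact ha.2 (le_antisymm (hx.2 ha.1 hba) hba)⟩
  exact ⟨rho, isCover_of_cells_eq (x := x) (Finset.notMem_erase _ _)
    (Finset.insert_erase hx.1).symm⟩

theorem exists_isCover_of_addable (rho : YoungDiagram) (i : ℕ)
    (hi : ∀ k < i, rho.rowLen i < rho.rowLen k) :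
    ∃ lam, ∃ h : IsCover rho lam, h.box = (i, rho.rowLen i) := by
  let lam : YoungDiagram := ⟨insert (i, rho.rowLen i) rho.cells, fun a b hba ha => by
    simp only [Finset.coe_insert, Set.mem_insert_iff, Finset.mem_coe] at ha ⊢
    rcases ha with rfl | ha
    · refine or_iff_not_imp_left.2 fun hb => ?_
      rw [YoungDiagram.mem_cells, ← Prod.mk.eta (p := b), YoungDiagram.mem_iff_lt_rowLen]
      have h1 : b.1 ≤ i := hba.1
      have h2 : b.2 ≤ rho.rowLen i := hba.2
      rcases h1.lt_or_eq with h1 | h1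
      · exact h2.trans_lt (hi _ h1)
      · rw [h1]
        exact lt_of_le_of_ne h2 fun h3 => hb (Prod.ext h1 h3)
    · exact Or.inr (rho.isLowerSet hba ha)⟩
  have hn : (i, rho.rowLen i) ∉ rho.cells := by
    rw [YoungDiagram.mem_cells, YoungDiagram.mem_iff_lt_rowLen]
    exact lt_irrefl _
  have hc : IsCover rho lam := isCover_of_cells_eq hn rfl
  exact ⟨lam, hc, hc.box_eq hn (Finset.mem_insert_self _ _)⟩

theorem exists_isCover_succ (h : IsCover sigma rho) :
    ∃ lam, ∃ h' : IsCover rho lam, h'.box.1 = h.box.1 + 1 := by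
  obtain ⟨lam, h', hb⟩ := exists_isCover_of_addable rho (h.box.1 + 1) fun k hk => by
    have h1 : (h.box.1, h.box.2) ∈ rho.cells := by
      rw [h.cells_eq]; exact Finset.mem_insert_self _ _
    rw [YoungDiagram.mem_cells, YoungDiagram.mem_iff_lt_rowLen] at h1
    have h2 : (h.box.1 + 1, h.box.2) ∉ rho.cells := by
      rw [h.cells_eq, Finset.mem_insert, not_or]
      refine ⟨fun e => ?_, fun e => ?_⟩
      · have := congrArg Prod.fst e
        simp at this
      · exact h.not_le_box e ⟨Nat.le_succ _, le_rfl⟩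
    rw [YoungDiagram.mem_cells, YoungDiagram.mem_iff_lt_rowLen] at h2
    have := rho.rowLen_anti k h.box.1 (by omega)
    omega
  exact ⟨lam, h', by rw [hb]⟩

/-- A box can always be added to the top row, and to the row just below any removable box; these
rows are distinct. -/
theorem card_lowerCovers_lt_card_upperCovers (rho : YoungDiagram) :
    (lowerCovers rho).card + 1 ≤ (upperCovers rho).card := by
  obtain ⟨lam0, h0, hb0⟩ := exists_isCover_of_addable rho 0 (by simp)
  have hex : ∀ sigma ∈ lowerCovers rho, ∃ lam, ∃ h' : IsCover rho lam, ∃ h : IsCover sigma rho,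
      h'.box.1 = h.box.1 + 1 := fun sigma hs => by
    obtain ⟨lam, h', hb⟩ := exists_isCover_succ (mem_lowerCovers.1 hs)
    exact ⟨lam, h', _, hb⟩
  choose! f hf using hex
  have hinj : Set.InjOn f (lowerCovers rho) := by
    intro s hs t ht hst
    obtain ⟨h1, h2, h3⟩ := hf s hs
    obtain ⟨h4, h5, h6⟩ := hf t ht
    have h7 : h1.box = h4.box := by
      refine h1.box_eq h4.box_notMem ?_
      rw [hst, h4.cells_eq]
      exact Finset.mem_insert_self _ _
    have h8 : h2.box.1 = h5.box.1 := by
      have := congrArg Prod.fst h7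
      omega
    have hm2 : h2.box ∈ rho.cells := by rw [h2.cells_eq]; exact Finset.mem_insert_self _ _
    have hm5 : h5.box ∈ rho.cells := by rw [h5.cells_eq]; exact Finset.mem_insert_self _ _
    refine h2.ext_lower h5 ?_
    by_contra hne
    have hne' : h2.box ≠ h5.box := fun e => hne (by rw [e])
    rcases le_total h2.box.2 h5.box.2 with hle | hle
    · rw [h2.cells_eq, Finset.mem_insert] at hm5
      exact h2.not_le_box (hm5.resolve_left (Ne.symm hne')) ⟨h8.le, hle⟩
    · rw [h5.cells_eq, Finset.mem_insert] at hm2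
      exact h5.not_le_box (hm2.resolve_left hne') ⟨h8.ge, hle⟩
  have hlam0 : lam0 ∉ (lowerCovers rho).image f := by
    intro hm
    obtain ⟨s, hs, rfl⟩ := Finset.mem_image.1 hm
    obtain ⟨h1, h2, h3⟩ := hf s hs
    have h7 : h1.box = h0.box := rfl
    rw [h7, hb0] at h3
    simp at h3
  rw [← Finset.card_image_of_injOn hinj, ← Finset.card_insert_of_notMem hlam0]
  refine Finset.card_le_card fun lam hl => mem_upperCovers.2 ?_
  rcases Finset.mem_insert.1 hl with rfl | hl
  · exact h0
  · obtain ⟨s, hs, rfl⟩ := Finset.mem_image.1 hl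
    exact (hf s hs).choose

/-- Both claims follow from $|\rho\cup\rho'| + |\rho\cap\rho'| = |\rho| + |\rho'|$. -/
theorem IsCover.inf_eq_and_sup (h : IsCover sigma rho) (h' : IsCover sigma rho')
    (hne : rho' ≠ rho) :
    rho ⊓ rho' = sigma ∧ IsCover rho (rho ⊔ rho') ∧ IsCover rho' (rho ⊔ rho') := by
  have hcard : (rho ⊔ rho').card + (rho ⊓ rho').card = rho.card + rho'.card := by
    simp only [YoungDiagram.card, YoungDiagram.cells_sup, YoungDiagram.cells_inf,
      Finset.card_union_add_card_inter]
  have hle : sigma ≤ rho ⊓ rho' := le_inf h.1 h'.1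
  have hlt : (rho ⊓ rho').card < rho.card := by
    refine Finset.card_lt_card (YoungDiagram.cells_ssubset_iff.2 (inf_lt_left.2 fun hl => ?_))
    have hs := Finset.eq_of_subset_of_card_le (YoungDiagram.cells_subset_iff.2 hl)
      (h'.2.trans h.2.symm).le
    exact hne (YoungDiagram.ext hs.symm)
  have h1 := h.2
  have h2 := h'.2
  have h3 : sigma = rho ⊓ rho' := by
    refine YoungDiagram.ext (Finset.eq_of_subset_of_card_le
      (YoungDiagram.cells_subset_iff.2 hle) ?_)
    change (rho ⊓ rho').card ≤ sigma.card
    omega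
  rw [← h3] at hcard
  exact ⟨h3.symm, ⟨le_sup_left, by omega⟩, ⟨le_sup_right, by omega⟩⟩

/-- Young's lattice is a differential poset; only this inequality is needed. -/
theorem add_sum_lowerCovers_le (f : YoungDiagram → ℕ) (rho : YoungDiagram) :
    f rho + ∑ sigma ∈ lowerCovers rho, ∑ tau ∈ upperCovers sigma, f tau ≤
      ∑ lam ∈ upperCovers rho, ∑ tau ∈ lowerCovers lam, f tau := by
  have h1 : ∀ sigma ∈ lowerCovers rho, ∑ tau ∈ upperCovers sigma, f tau =
      f rho + ∑ tau ∈ (upperCovers sigma).erase rho, f tau := fun sigma hs =>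
    (Finset.add_sum_erase _ _ (mem_upperCovers.2 (mem_lowerCovers.1 hs))).symm
  have h2 : ∀ lam ∈ upperCovers rho, ∑ tau ∈ lowerCovers lam, f tau =
      f rho + ∑ tau ∈ (lowerCovers lam).erase rho, f tau := fun lam hl =>
    (Finset.add_sum_erase _ _ (mem_lowerCovers.2 (mem_upperCovers.1 hl))).symm
  rw [Finset.sum_congr rfl h1, Finset.sum_congr rfl h2, Finset.sum_add_distrib,
    Finset.sum_add_distrib, ← add_assoc, Finset.sum_const, Finset.sum_const, smul_eq_mul,
    smul_eq_mul]
  have h3 : f rho + (lowerCovers rho).card * f rho ≤ (upperCovers rho).card * f rho := by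
    rw [add_comm, ← Nat.succ_mul]
    exact Nat.mul_le_mul_right _ (card_lowerCovers_lt_card_upperCovers rho)
  refine add_le_add h3 ?_
  rw [Finset.sum_sigma', Finset.sum_sigma']
  -- The terms with `tau = rho` are compared by `h3`. For `tau ≠ rho`, a path down through `sigma =
  -- rho ⊓ tau` corresponds to the path up through `rho ⊔ tau`.
  let φ : (Σ _ : YoungDiagram, YoungDiagram) → Σ _ : YoungDiagram, YoungDiagram :=
    fun p => ⟨rho ⊔ p.2, p.2⟩
  have hφ : ∀ p ∈ (lowerCovers rho).sigma fun sigma => (upperCovers sigma).erase rho,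
      rho ⊓ p.2 = p.1 ∧ IsCover rho (rho ⊔ p.2) ∧ IsCover p.2 (rho ⊔ p.2) ∧ p.2 ≠ rho := by
    intro p hp
    simp only [Finset.mem_sigma, mem_lowerCovers, Finset.mem_erase, mem_upperCovers] at hp
    obtain ⟨h4, h5, h6⟩ := hp.1.inf_eq_and_sup hp.2.2 hp.2.1
    exact ⟨h4, h5, h6, hp.2.1⟩
  have hinj : Set.InjOn φ ((lowerCovers rho).sigma fun sigma => (upperCovers sigma).erase rho) := by
    intro p hp q hq hpq
    have h4 : p.2 = q.2 := congrArg (fun r => r.2) hpq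
    have h5 : p.1 = q.1 := by rw [← (hφ p hp).1, ← (hφ q hq).1, h4]
    exact Sigma.ext h5 (heq_of_eq h4)
  rw [← Finset.sum_image (f := fun p => f p.2) (g := φ) hinj]
  refine Finset.sum_le_sum_of_subset fun p hp => ?_
  obtain ⟨q, hq, rfl⟩ := Finset.mem_image.1 hp
  obtain ⟨-, h5, h6, h7⟩ := hφ q hq
  simp only [φ, Finset.mem_sigma, mem_lowerCovers, Finset.mem_erase, mem_upperCovers]
  exact ⟨h5, h7, h6⟩

/-- A function on Young's lattice that grows at least like the number of paths downwards and at
most like the dimensions of induced representations is additive along covers. -/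
theorem eq_sum_lowerCovers {f : YoungDiagram → ℕ}
    (hlow : ∀ lam, ∑ rho ∈ lowerCovers lam, f rho ≤ f lam)
    (hup : ∀ rho, ∑ lam ∈ upperCovers rho, f lam ≤ (rho.card + 1) * f rho)
    (hlam : 0 < lam.card) : f lam = ∑ rho ∈ lowerCovers lam, f rho := by
  -- The lattice inequality, `hlow` and `hup` bound the sum over upper covers between two values. By
  -- induction both are `(n + 1) * f rho`, so every inequality in the chain, including `hlow` for
  -- each upper cover, is an equality.
  have key : ∀ n, ∀ rho : YoungDiagram, rho.card = n →
      (∑ lam ∈ upperCovers rho, f lam = (n + 1) * f rho) ∧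
        ∀ lam ∈ upperCovers rho, ∑ tau ∈ lowerCovers lam, f tau = f lam := by
    intro n
    induction n with
    | zero =>
      intro rho hrho
      have h1 := (Nat.le_add_right _ _).trans (add_sum_lowerCovers_le f rho)
      have h2 := Finset.sum_le_sum fun lam (_ : lam ∈ upperCovers rho) => hlow lam
      have h3 := hup rho
      rw [hrho] at h3
      exact ⟨by linarith, (Finset.sum_eq_sum_iff_of_le fun lam _ => hlow lam).1 (by linarith)⟩
    | succ n ih =>
      intro rho hrho
      have h1 := add_sum_lowerCovers_le f rho
      have h2 := Finset.sum_le_sum fun lam (_ : lam ∈ upperCovers rho) => hlow lam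
      have h3 := hup rho
      have hc : ∀ sigma ∈ lowerCovers rho, sigma.card = n := fun sigma hs => by
        have := (mem_lowerCovers.1 hs).2
        omega
      obtain ⟨sigma, hs⟩ := exists_isCover_of_card_pos (lam := rho) (by omega)
      have h4 := (ih sigma (hc sigma (mem_lowerCovers.2 hs))).2 rho (mem_upperCovers.2 hs)
      rw [Finset.sum_congr rfl fun sigma hs => (ih sigma (hc sigma hs)).1, ← Finset.mul_sum,
        h4] at h1
      rw [hrho] at h3
      have h5 : f rho + (n + 1) * f rho = (n + 1 + 1) * f rho := by ring
      exact ⟨by linarith, (Finset.sum_eq_sum_iff_of_le fun lam _ => hlow lam).1 (by linarith)⟩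
  obtain ⟨rho, hr⟩ := exists_isCover_of_card_pos hlam
  exact ((key _ rho rfl).2 lam (mem_upperCovers.2 hr)).symm

end YoungLattice

/-! ### Joint injectivity through distinct eigenvalues -/

section Eigenvectors

/-- Injective maps into distinct eigenspaces are jointly injective. -/
theorem lsum_injective_of_eigen {ι : Type*} [Fintype ι] {V : Type*} [AddCommGroup V]
    [Module ℂ V] {M : ι → Type*} [∀ i, AddCommGroup (M i)] [∀ i, Module ℂ (M i)]
    (F : Module.End ℂ V) (μ : ι → ℂ) (hμ : Function.Injective μ) (j : ∀ i, M i →ₗ[ℂ] V)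
    (hj : ∀ i, Function.Injective (j i)) (hF : ∀ i x, F (j i x) = μ i • j i x) :
    Function.Injective (LinearMap.lsum ℂ M ℂ j) := by
  rw [injective_iff_map_eq_zero]
  intro x hx
  rw [LinearMap.lsum_apply, LinearMap.sum_apply] at hx
  have hind := (F.eigenspaces_iSupIndep).comp hμ
  rw [iSupIndep_iff_finsetSum_eq_zero_imp_eq_zero] at hind
  have h := hind Finset.univ (fun i => j i (x i))
    (fun i _ => Module.End.mem_eigenspace_iff.2 (hF i (x i))) hx
  funext i
  exact (injective_iff_map_eq_zero _).1 (hj i) _ (h i (Finset.mem_univ i))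

theorem sum_finrank_le_of_eigen {ι : Type*} [Fintype ι] {V : Type*} [AddCommGroup V]
    [Module ℂ V] [FiniteDimensional ℂ V] {M : ι → Type*} [∀ i, AddCommGroup (M i)]
    [∀ i, Module ℂ (M i)] [∀ i, FiniteDimensional ℂ (M i)]
    (F : Module.End ℂ V) (μ : ι → ℂ) (hμ : Function.Injective μ) (j : ∀ i, M i →ₗ[ℂ] V)
    (hj : ∀ i, Function.Injective (j i)) (hF : ∀ i x, F (j i x) = μ i • j i x) :
    ∑ i, Module.finrank ℂ (M i) ≤ Module.finrank ℂ V := by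
  rw [← Module.finrank_pi_fintype]
  exact LinearMap.finrank_le_finrank_of_injective (lsum_injective_of_eigen F μ hμ j hj hF)

end Eigenvectors

/-! ### Restriction, induction and the branching rule -/

section Branching

variable {β : Type*} [Fintype β] [DecidableEq β] {lam rho : YoungDiagram}

theorem swapSum_mul_of_mem_specht {T : β ≃ rho.cells} {x : ℂ[Equiv.Perm β]}
    (hx : x ∈ specht T) : swapSum β * x = swapEigenvalue rho • x := by
  obtain ⟨u, rfl⟩ := mem_specht.1 hx
  rw [← mul_assoc, ← mul_swapSum, mul_assoc, swapSum_mul_youngSymmetrizer, mul_smul_comm]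

/-- The right multiplication that embeds a smaller Specht module. -/
def restrictFactor (h : IsCover rho lam) (T : β ≃ rho.cells) (T' : Option β ≃ lam.cells) :
    ℂ[Equiv.Perm (Option β)] :=
  (exists_incl_mul_youngSymmetrizer_ne_zero h T T').choose

theorem incl_mul_restrictFactor_ne_zero (h : IsCover rho lam) (T : β ≃ rho.cells)
    (T' : Option β ≃ lam.cells) :
    incl (youngSymmetrizer T) * (restrictFactor h T T' * youngSymmetrizer T') ≠ 0 :=
  (exists_incl_mul_youngSymmetrizer_ne_zero h T T').choose_spec

/-- An embedding of the Specht module of a smaller diagram. -/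
def restrictMap (h : IsCover rho lam) (T : β ≃ rho.cells) (T' : Option β ≃ lam.cells) :
    specht T →ₗ[ℂ] specht T' where
  toFun x := ⟨incl x.1 * (restrictFactor h T T' * youngSymmetrizer T'),
    mem_specht.2 ⟨incl x.1 * restrictFactor h T T', mul_assoc _ _ _⟩⟩
  map_add' x y := Subtype.ext (by simp [add_mul])
  map_smul' r x := Subtype.ext (by simp)

theorem coe_restrictMap (h : IsCover rho lam) (T : β ≃ rho.cells) (T' : Option β ≃ lam.cells)
    (x : specht T) : (restrictMap h T T' x : ℂ[Equiv.Perm (Option β)]) =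
      incl x.1 * (restrictFactor h T T' * youngSymmetrizer T') := rfl

theorem restrictMap_injective (h : IsCover rho lam) (T : β ≃ rho.cells)
    (T' : Option β ≃ lam.cells) : Function.Injective (restrictMap h T T') := by
  rw [injective_iff_map_eq_zero]
  rintro ⟨x, hx⟩ h0
  obtain ⟨u, rfl⟩ := mem_specht.1 hx
  have h1 := congrArg Subtype.val h0
  rw [coe_restrictMap] at h1
  exact Subtype.ext (mul_youngSymmetrizer_eq_zero T incl
    (incl_mul_restrictFactor_ne_zero h T T') h1)

theorem leftAct_incl_restrictMap (h : IsCover rho lam) (T : β ≃ rho.cells)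
    (T' : Option β ≃ lam.cells) (u : ℂ[Equiv.Perm β]) :
    leftAct T' (incl u) ∘ₗ restrictMap h T T' = restrictMap h T T' ∘ₗ leftAct T u := by
  ext x : 2
  simp [coe_restrictMap, mul_assoc]

/-- On the image the class sums of both groups act by scalars. By `swapSum_option` the eigenvalue is
half of their difference minus one, which is the content of the removed box. -/
theorem leftAct_jucysMurphy_restrictMap (h : IsCover rho lam) (T : β ≃ rho.cells)
    (T' : Option β ≃ lam.cells) (x : specht T) :
    leftAct T' (jucysMurphy β) (restrictMap h T T' x) =
      (content h.box : ℂ) • restrictMap h T T' x := by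
  refine Subtype.ext ?_
  set y := restrictMap h T T' x with hy
  have h1 := swapSum_mul_of_mem_specht y.2
  have h2 : incl (swapSum β) * (y : ℂ[Equiv.Perm (Option β)]) = swapEigenvalue rho • y.1 := by
    rw [hy, coe_restrictMap, ← mul_assoc, ← map_mul, swapSum_mul_of_mem_specht x.2, map_smul,
      smul_mul_assoc]
  rw [swapSum_option, add_mul, add_mul, h2, one_mul, h.swapEigenvalue_eq, add_smul, add_smul,
    one_smul, mul_smul, two_mul, add_mul, ← two_smul ℂ] at h1
  have h3 : (2 : ℂ) • (jucysMurphy β * y.1) = (2 : ℂ) • ((content h.box : ℂ) • y.1) := by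
    have := congrArg (fun z => z - swapEigenvalue rho • y.1 - y.1) h1
    simpa [add_sub_cancel_left, add_assoc, add_comm, add_left_comm, sub_sub] using this
  exact smul_right_injective _ (two_ne_zero' ℂ) h3

/-- The left ideal that is generated by the Young symmetrizer of `T` in the larger group algebra,
the induced representation. -/
def inducedIdeal (T : β ≃ rho.cells) : Submodule ℂ ℂ[Equiv.Perm (Option β)] :=
  LinearMap.range (LinearMap.mulRight ℂ (incl (youngSymmetrizer T)))

/-- The swaps of `none` with an arbitrary element represent the cosets of the smaller group, so as
many translates of its Specht module span the ideal. -/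
theorem finrank_inducedIdeal_le (T : β ≃ rho.cells) :
    Module.finrank ℂ (inducedIdeal T) ≤ (rho.card + 1) * dim rho := by
  let φ : (Option β → specht T) →ₗ[ℂ] ℂ[Equiv.Perm (Option β)] :=
    LinearMap.lsum ℂ (fun _ : Option β => specht T) ℂ fun o =>
      LinearMap.mulLeft ℂ (MonoidAlgebra.single (Equiv.swap none o) 1) ∘ₗ
        incl.toLinearMap ∘ₗ (specht T).subtype
  have hle : inducedIdeal T ≤ LinearMap.range φ := by
    rintro _ ⟨x, rfl⟩
    induction x using MonoidAlgebra.induction_linear with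
    | zero => simp
    | add x y hx hy => rw [map_add]; exact add_mem hx hy
    | single g r =>
      obtain ⟨⟨o, k⟩, rfl⟩ := Equiv.Perm.decomposeOption.symm.surjective g
      refine ⟨Pi.single o ⟨MonoidAlgebra.single k r * youngSymmetrizer T,
        mem_specht.2 ⟨_, rfl⟩⟩, ?_⟩
      simp only [φ, LinearMap.lsum_piSingle]
      simp [← mul_assoc, MonoidAlgebra.single_mul_single]
  calc Module.finrank ℂ (inducedIdeal T) ≤ Module.finrank ℂ (LinearMap.range φ) :=
        Submodule.finrank_mono hle
    _ ≤ Module.finrank ℂ (Option β → specht T) := LinearMap.finrank_range_le φ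
    _ = (rho.card + 1) * dim rho := by
        have hc : Fintype.card β = rho.card := by
          rw [Fintype.card_congr T, Fintype.card_coe]
        rw [Module.finrank_pi_fintype]
        simp [finrank_specht, hc]

/-- The right multiplication that embeds a larger Specht module. -/
def induceFactor (h : IsCover rho lam) (T : β ≃ rho.cells) (T' : Option β ≃ lam.cells) :
    ℂ[Equiv.Perm (Option β)] :=
  (exists_youngSymmetrizer_mul_incl_ne_zero h T T').choose

theorem mul_induceFactor_ne_zero (h : IsCover rho lam) (T : β ≃ rho.cells)
    (T' : Option β ≃ lam.cells) :
    youngSymmetrizer T' * (induceFactor h T T' * incl (youngSymmetrizer T)) ≠ 0 :=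
  (exists_youngSymmetrizer_mul_incl_ne_zero h T T').choose_spec

/-- An embedding of the Specht module of a larger diagram. -/
def induceMap (h : IsCover rho lam) (T : β ≃ rho.cells) (T' : Option β ≃ lam.cells) :
    specht T' →ₗ[ℂ] inducedIdeal T where
  toFun x := ⟨x.1 * (induceFactor h T T' * incl (youngSymmetrizer T)),
    ⟨x.1 * induceFactor h T T', mul_assoc _ _ _⟩⟩
  map_add' x y := Subtype.ext (by simp [add_mul])
  map_smul' r x := Subtype.ext (by simp)

theorem coe_induceMap (h : IsCover rho lam) (T : β ≃ rho.cells) (T' : Option β ≃ lam.cells)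
    (x : specht T') : (induceMap h T T' x : ℂ[Equiv.Perm (Option β)]) =
      x.1 * (induceFactor h T T' * incl (youngSymmetrizer T)) := rfl

theorem induceMap_injective (h : IsCover rho lam) (T : β ≃ rho.cells)
    (T' : Option β ≃ lam.cells) : Function.Injective (induceMap h T T') := by
  rw [injective_iff_map_eq_zero]
  rintro ⟨x, hx⟩ h0
  obtain ⟨u, rfl⟩ := mem_specht.1 hx
  have h1 := congrArg Subtype.val h0
  rw [coe_induceMap] at h1
  exact Subtype.ext (mul_youngSymmetrizer_eq_zero T' (AlgHom.id ℂ _)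
    (mul_induceFactor_ne_zero h T T') h1)

/-- The action of the central element `swapSum` on the induced representation. -/
def swapSumAct (T : β ≃ rho.cells) : Module.End ℂ (inducedIdeal T) :=
  (LinearMap.mulLeft ℂ (swapSum (Option β))).restrict <| by
    rintro _ ⟨x, rfl⟩
    exact ⟨swapSum (Option β) * x, mul_assoc _ _ _⟩

theorem swapSumAct_induceMap (h : IsCover rho lam) (T : β ≃ rho.cells)
    (T' : Option β ≃ lam.cells) (x : specht T') :
    swapSumAct T (induceMap h T T' x) = swapEigenvalue lam • induceMap h T T' x := by
  refine Subtype.ext ?_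
  change swapSum (Option β) * (induceMap h T T' x).1 = swapEigenvalue lam • (induceMap h T T' x).1
  rw [coe_induceMap, ← mul_assoc, swapSum_mul_of_mem_specht x.2, smul_mul_assoc]

/-- A filling of a diagram by a type of the same size. -/
def filling (β : Type*) [Fintype β] (rho : YoungDiagram) (h : Fintype.card β = rho.card) :
    β ≃ rho.cells :=
  Fintype.equivOfCardEq (by rw [h, Fintype.card_coe])

theorem content_injective_upperCovers (rho : YoungDiagram) :
    Function.Injective fun lam : upperCovers rho => content (mem_upperCovers.1 lam.2).box :=
  fun a b h => Subtype.ext ((mem_upperCovers.1 a.2).ext_upper (mem_upperCovers.1 b.2) h)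

theorem content_injective_lowerCovers (lam : YoungDiagram) :
    Function.Injective fun rho : lowerCovers lam =>
      (content (mem_lowerCovers.1 rho.2).box : ℂ) :=
  fun a b h => Subtype.ext ((mem_lowerCovers.1 a.2).ext_lower (mem_lowerCovers.1 b.2)
    (Int.cast_injective h))

/-- The larger Specht modules embed in the induced ideal, where the central `swapSum` separates
them. -/
theorem sum_dim_upperCovers_le (rho : YoungDiagram) :
    ∑ lam ∈ upperCovers rho, dim lam ≤ (rho.card + 1) * dim rho := by
  have hc : ∀ lam : upperCovers rho, Fintype.card (Option (Fin rho.card)) = lam.1.card :=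
    fun lam => by
      rw [Fintype.card_option, Fintype.card_fin]
      exact (mem_upperCovers.1 lam.2).2.symm
  let T := tableau rho
  refine le_trans ?_ (finrank_inducedIdeal_le T)
  have h := sum_finrank_le_of_eigen (swapSumAct T) (fun lam : upperCovers rho => swapEigenvalue lam.1)
    (fun a b hab => content_injective_upperCovers rho ?_)
    (fun lam => induceMap (mem_upperCovers.1 lam.2) T (filling _ _ (hc lam)))
    (fun lam => induceMap_injective _ _ _) (fun lam x => swapSumAct_induceMap _ _ _ x)
  · simp only [finrank_specht] at h
    rwa [Finset.sum_coe_sort (upperCovers rho) dim] at h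
  · simp only [(mem_upperCovers.1 a.2).swapEigenvalue_eq,
      (mem_upperCovers.1 b.2).swapEigenvalue_eq] at hab
    have h2 := mul_left_cancel₀ (two_ne_zero' ℂ) (add_left_cancel hab)
    exact Int.cast_injective h2

theorem card_lower {lam : YoungDiagram} (T' : Option β ≃ lam.cells) (rho : lowerCovers lam) :
    Fintype.card β = rho.1.card := by
  have h1 := Fintype.card_congr T'
  rw [Fintype.card_option, Fintype.card_coe] at h1
  have h2 := (mem_lowerCovers.1 rho.2).2
  rw [YoungDiagram.card] at h2
  omega

/-- All embeddings of Specht modules of diagrams with one box less. -/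
def lowerMap (T' : Option β ≃ lam.cells) (rho : lowerCovers lam) :
    specht (filling β rho.1 (card_lower T' rho)) →ₗ[ℂ] specht T' :=
  restrictMap (mem_lowerCovers.1 rho.2) _ T'

theorem lsum_lowerMap_injective (T' : Option β ≃ lam.cells) :
    Function.Injective (LinearMap.lsum ℂ _ ℂ (lowerMap T')) :=
  lsum_injective_of_eigen (leftAct T' (jucysMurphy β))
    (fun rho : lowerCovers lam => (content (mem_lowerCovers.1 rho.2).box : ℂ))
    (content_injective_lowerCovers lam) (lowerMap T')
    (fun rho => restrictMap_injective (mem_lowerCovers.1 rho.2) _ T')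
    fun rho x => leftAct_jucysMurphy_restrictMap (mem_lowerCovers.1 rho.2) _ T' x

theorem finrank_pi_lower (T' : Option β ≃ lam.cells) :
    Module.finrank ℂ (∀ rho : lowerCovers lam, specht (filling β rho.1 (card_lower T' rho))) =
      ∑ rho ∈ lowerCovers lam, dim rho := by
  rw [Module.finrank_pi_fintype]
  simp only [finrank_specht]
  exact Finset.sum_coe_sort (lowerCovers lam) dim

/-- The smaller Specht modules embed in the larger one, where the Jucys–Murphy element separates
them by content. -/
theorem sum_dim_lowerCovers_le (lam : YoungDiagram) :
    ∑ rho ∈ lowerCovers lam, dim rho ≤ dim lam := by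
  rcases Nat.eq_zero_or_pos lam.card with h0 | h0
  · rw [Finset.sum_eq_zero fun rho h => by
      have := (mem_lowerCovers.1 h).2
      omega]
    exact Nat.zero_le _
  · let T' : Option (Fin (lam.card - 1)) ≃ lam.cells := filling _ _ (by
      rw [Fintype.card_option, Fintype.card_fin]
      omega)
    rw [← finrank_pi_lower T', ← finrank_specht T']
    exact LinearMap.finrank_le_finrank_of_injective (lsum_lowerMap_injective T')

/-- The branching rule for dimensions. -/
theorem dim_eq_sum_lowerCovers (h : 0 < lam.card) :
    dim lam = ∑ rho ∈ lowerCovers lam, dim rho :=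
  eq_sum_lowerCovers sum_dim_lowerCovers_le sum_dim_upperCovers_le h

/-- The branching rule: a Specht module is the direct sum of the Specht modules of the diagrams
with one box less. -/
def branchingEquiv (T' : Option β ≃ lam.cells) :
    (∀ rho : lowerCovers lam, specht (filling β rho.1 (card_lower T' rho))) ≃ₗ[ℂ] specht T' :=
  LinearEquiv.ofInjectiveOfFinrankEq _ (lsum_lowerMap_injective T') <| by
    have hpos : 0 < lam.card := Finset.card_pos.2 ⟨_, (T' none).2⟩
    rw [finrank_pi_lower T', finrank_specht, dim_eq_sum_lowerCovers hpos]

theorem branchingEquiv_single (T' : Option β ≃ lam.cells) (rho : lowerCovers lam)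
    (x : specht (filling β rho.1 (card_lower T' rho))) :
    branchingEquiv T' (Pi.single rho x) = lowerMap T' rho x := by
  change LinearMap.lsum ℂ _ ℂ (lowerMap T') (Pi.single rho x) = _
  rw [LinearMap.lsum_piSingle]

/-- The projections that belong to the embeddings `lowerMap`. -/
def lowerProj (T' : Option β ≃ lam.cells) (rho : lowerCovers lam) :
    specht T' →ₗ[ℂ] specht (filling β rho.1 (card_lower T' rho)) :=
  LinearMap.proj rho ∘ₗ (branchingEquiv T').symm.toLinearMap

theorem sum_lowerMap_lowerProj (T' : Option β ≃ lam.cells) :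
    ∑ rho, lowerMap T' rho ∘ₗ lowerProj T' rho = LinearMap.id := by
  ext1 x
  obtain ⟨y, rfl⟩ := (branchingEquiv T').surjective x
  rw [LinearMap.sum_apply]
  simp only [LinearMap.comp_apply, lowerProj, LinearEquiv.coe_coe, LinearEquiv.symm_apply_apply,
    LinearMap.proj_apply, LinearMap.id_apply, ← branchingEquiv_single]
  rw [← map_sum, Finset.univ_sum_single]

theorem lowerProj_lowerMap (T' : Option β ≃ lam.cells) (rho : lowerCovers lam) :
    lowerProj T' rho ∘ₗ lowerMap T' rho = LinearMap.id := by
  ext1 x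
  simp [lowerProj, ← branchingEquiv_single]

theorem lowerProj_lowerMap_of_ne (T' : Option β ≃ lam.cells) {rho rho' : lowerCovers lam}
    (h : rho ≠ rho') : lowerProj T' rho ∘ₗ lowerMap T' rho' = 0 := by
  ext1 x
  simp [lowerProj, ← branchingEquiv_single, Pi.single_eq_of_ne h]

end Branching

/-- A linear form of the relation between a transposition and two Jucys–Murphy elements,
compressed to a common eigenspace. -/
theorem sub_smul_comp_eq {V W U : Type*} [AddCommGroup V] [Module ℂ V] [AddCommGroup W]
    [Module ℂ W] [AddCommGroup U] [Module ℂ U] {j : W →ₗ[ℂ] V} {q : V →ₗ[ℂ] W}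
    {j' : U →ₗ[ℂ] W} {q' : W →ₗ[ℂ] U} {t X Y G : Module.End ℂ V} {Y' G' : Module.End ℂ W}
    {G'' : Module.End ℂ U} {a b : ℂ} (hX : X ∘ₗ j = a • j) (hY : q ∘ₗ Y = Y' ∘ₗ q)
    (hY' : q' ∘ₗ Y' = b • q') (hG : q ∘ₗ G = G' ∘ₗ q) (hG' : q' ∘ₗ G' = G'' ∘ₗ q')
    (hj : q ∘ₗ j = LinearMap.id) (hj' : q' ∘ₗ j' = LinearMap.id)
    (ht : t ∘ₗ X = Y ∘ₗ t + LinearMap.id) :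
    (a - b) • (q' ∘ₗ (q ∘ₗ (G ∘ₗ t) ∘ₗ j) ∘ₗ j') = G'' := by
  ext u
  have e1 := fun x => LinearMap.congr_fun hX x
  have e2 := fun x => LinearMap.congr_fun hY x
  have e3 := fun x => LinearMap.congr_fun hY' x
  have e4 := fun x => LinearMap.congr_fun hG x
  have e5 := fun x => LinearMap.congr_fun hG' x
  have e6 := fun x => LinearMap.congr_fun hj x
  have e7 := fun x => LinearMap.congr_fun hj' x
  -- Applying `G'' ∘ q' ∘ q` to the relation at `j (j' u)` replaces `X` by `a` and `Y` by `b`,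
  -- leaving `G'' u` as the difference.
  have e8 := congrArg (fun x => G'' (q' (q x))) (LinearMap.congr_fun ht (j (j' u)))
  simp only [LinearMap.comp_apply, LinearMap.smul_apply, LinearMap.add_apply,
    LinearMap.id_apply] at e1 e2 e3 e4 e5 e6 e7 e8
  rw [e1, map_add, map_add, map_add, e2, e3, e6, e7] at e8
  simp only [map_smul] at e8
  rw [LinearMap.smul_apply, LinearMap.comp_apply, LinearMap.comp_apply, LinearMap.comp_apply,
    LinearMap.comp_apply, LinearMap.comp_apply, e4, e5, sub_smul, e8, add_sub_cancel_left]

theorem comp_finsetSum {ι V W U : Type*} [AddCommGroup V] [Module ℂ V] [AddCommGroup W]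
    [Module ℂ W] [AddCommGroup U] [Module ℂ U] (F : W →ₗ[ℂ] U) (s : Finset ι)
    (f : ι → V →ₗ[ℂ] W) : F ∘ₗ ∑ i ∈ s, f i = ∑ i ∈ s, F ∘ₗ f i := by
  ext x
  simp

/-! ### Block traces along one removed box -/

section OneStep

variable {β : Type*} [Fintype β] [DecidableEq β] {lam : YoungDiagram}

/-- Inserting the resolution of the identity before `lowerProj T' rho ∘ₗ F` leaves only the block of
`rho`. -/
theorem lowerProj_comp_of_comp_lowerMap (T' : Option β ≃ lam.cells)
    (F : Module.End ℂ (specht T'))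
    (f : ∀ rho : lowerCovers lam, Module.End ℂ (specht (filling β rho.1 (card_lower T' rho))))
    (h : ∀ rho, F ∘ₗ lowerMap T' rho = lowerMap T' rho ∘ₗ f rho) (rho : lowerCovers lam) :
    lowerProj T' rho ∘ₗ F = f rho ∘ₗ lowerProj T' rho := by
  calc lowerProj T' rho ∘ₗ F
      = lowerProj T' rho ∘ₗ F ∘ₗ ∑ k, lowerMap T' k ∘ₗ lowerProj T' k := by
        rw [sum_lowerMap_lowerProj, LinearMap.comp_id]
    _ = ∑ k, (lowerProj T' rho ∘ₗ lowerMap T' k) ∘ₗ f k ∘ₗ lowerProj T' k := by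
        rw [← LinearMap.comp_assoc, comp_finsetSum]
        refine Finset.sum_congr rfl fun k _ => ?_
        rw [← LinearMap.comp_assoc, LinearMap.comp_assoc _ F, h k]
        simp only [LinearMap.comp_assoc]
    _ = f rho ∘ₗ lowerProj T' rho := by
        rw [Finset.sum_eq_single rho]
        · rw [lowerProj_lowerMap, LinearMap.id_comp]
        · intro k _ hk
          rw [lowerProj_lowerMap_of_ne T' hk.symm, LinearMap.zero_comp]
        · simp

theorem leftAct_incl_lowerMap (T' : Option β ≃ lam.cells) (u : ℂ[Equiv.Perm β])
    (rho : lowerCovers lam) :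
    leftAct T' (incl u) ∘ₗ lowerMap T' rho = lowerMap T' rho ∘ₗ leftAct _ u :=
  leftAct_incl_restrictMap _ _ _ u

theorem lowerProj_leftAct_incl (T' : Option β ≃ lam.cells) (u : ℂ[Equiv.Perm β])
    (rho : lowerCovers lam) :
    lowerProj T' rho ∘ₗ leftAct T' (incl u) = leftAct _ u ∘ₗ lowerProj T' rho :=
  lowerProj_comp_of_comp_lowerMap T' _ _ (leftAct_incl_lowerMap T' u) rho

theorem leftAct_jucysMurphy_lowerMap (T' : Option β ≃ lam.cells) (rho : lowerCovers lam) :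
    leftAct T' (jucysMurphy β) ∘ₗ lowerMap T' rho =
      (content (mem_lowerCovers.1 rho.2).box : ℂ) • lowerMap T' rho :=
  LinearMap.ext fun x => leftAct_jucysMurphy_restrictMap _ _ _ x

theorem lowerProj_leftAct_jucysMurphy (T' : Option β ≃ lam.cells) (rho : lowerCovers lam) :
    lowerProj T' rho ∘ₗ leftAct T' (jucysMurphy β) =
      (content (mem_lowerCovers.1 rho.2).box : ℂ) • lowerProj T' rho := by
  rw [lowerProj_comp_of_comp_lowerMap T' _
    (fun rho => (content (mem_lowerCovers.1 rho.2).box : ℂ) • LinearMap.id) (fun k => by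
      rw [leftAct_jucysMurphy_lowerMap, LinearMap.comp_smul, LinearMap.comp_id]) rho,
    LinearMap.smul_comp, LinearMap.id_comp]

theorem trace_eq_sum_lowerCovers (T' : Option β ≃ lam.cells) (F : Module.End ℂ (specht T')) :
    LinearMap.trace ℂ _ F =
      ∑ rho, LinearMap.trace ℂ _ (lowerProj T' rho ∘ₗ F ∘ₗ lowerMap T' rho) := by
  calc LinearMap.trace ℂ _ F
      = LinearMap.trace ℂ _ (F ∘ₗ ∑ k, lowerMap T' k ∘ₗ lowerProj T' k) := by
        rw [sum_lowerMap_lowerProj, LinearMap.comp_id]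
    _ = _ := by
        rw [comp_finsetSum, map_sum]
        refine Finset.sum_congr rfl fun k _ => ?_
        rw [← LinearMap.comp_assoc, LinearMap.trace_comp_comm']

/-- The branching rule for characters. -/
theorem spechtTrace_incl (T' : Option β ≃ lam.cells) (u : ℂ[Equiv.Perm β]) :
    spechtTrace T' (incl u) =
      ∑ rho : lowerCovers lam, spechtTrace (filling β rho.1 (card_lower T' rho)) u := by
  rw [spechtTrace, trace_eq_sum_lowerCovers]
  refine Finset.sum_congr rfl fun rho _ => ?_
  rw [← LinearMap.comp_assoc, lowerProj_leftAct_incl, LinearMap.comp_assoc, lowerProj_lowerMap,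
    LinearMap.comp_id, spechtTrace]

end OneStep

/-! ### Block traces of a transposition along two removed boxes -/

section TwoStep

variable {γ : Type*} [Fintype γ] [DecidableEq γ] {lam : YoungDiagram}

variable (γ) in
/-- The transposition of the two elements that are added to `γ`. -/
def topSwap : Equiv.Perm (Option (Option γ)) := Equiv.swap none (some none)

/-- Conjugation by the transposition carries all but one summand of one Jucys–Murphy element to the
other; the remaining summand is the transposition itself, with square $1$. -/
theorem topSwap_mul_jucysMurphy :
    MonoidAlgebra.single (topSwap γ) (1 : ℂ) * jucysMurphy (Option γ) =
      incl (jucysMurphy γ) * MonoidAlgebra.single (topSwap γ) 1 + 1 := by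
  have h : ∀ c : γ, topSwap γ * Equiv.swap none (some (some c)) =
      Equiv.swap (some none) (some (some c)) * topSwap γ := fun c => by
    rw [topSwap, Equiv.mul_swap_eq_swap_mul, Equiv.swap_apply_left,
      Equiv.swap_apply_of_ne_of_ne (by simp) (by simp)]
  simp only [jucysMurphy, Fintype.sum_option, mul_add, map_sum, incl_single,
    Equiv.optionCongr_swap, Finset.mul_sum, Finset.sum_mul, MonoidAlgebra.single_mul_single, h]
  rw [add_comm]
  congr 1
  simp [topSwap, MonoidAlgebra.one_def]

variable (T : Option (Option γ) ≃ lam.cells) (rho : lowerCovers lam) (sigma : lowerCovers rho.1)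

/-- The difference of the contents of the two boxes along a path. -/
def axialDistance {lam : YoungDiagram} (rho : lowerCovers lam) (sigma : lowerCovers rho.1) : ℂ :=
  content (mem_lowerCovers.1 rho.2).box - content (mem_lowerCovers.1 sigma.2).box

/-- This is the diagonal part of Young's seminormal form; the off-diagonal blocks do not enter a
trace. -/
theorem axialDistance_smul (v : ℂ[Equiv.Perm γ]) :
    axialDistance rho sigma •
      (lowerProj (filling _ rho.1 (card_lower T rho)) sigma ∘ₗ (lowerProj T rho ∘ₗ
      leftAct T (incl (incl v) * MonoidAlgebra.single (topSwap γ) 1) ∘ₗ lowerMap T rho) ∘ₗ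
      lowerMap (filling _ rho.1 (card_lower T rho)) sigma) =
    leftAct (filling γ sigma.1 (card_lower (filling _ rho.1 (card_lower T rho)) sigma)) v := by
  rw [leftAct_mul, axialDistance]
  refine sub_smul_comp_eq (leftAct_jucysMurphy_lowerMap T rho)
    (lowerProj_leftAct_incl T (jucysMurphy γ) rho)
    (lowerProj_leftAct_jucysMurphy (filling _ rho.1 (card_lower T rho)) sigma)
    (lowerProj_leftAct_incl T (incl v) rho)
    (lowerProj_leftAct_incl (filling _ rho.1 (card_lower T rho)) v sigma)
    (lowerProj_lowerMap T rho) (lowerProj_lowerMap (filling _ rho.1 (card_lower T rho)) sigma) ?_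
  rw [← leftAct_mul, ← leftAct_mul, ← leftAct_one, ← leftAct_add, topSwap_mul_jucysMurphy]

/-- For `v = 1` a vanishing distance would make the identity of a nonzero module zero, so no
combinatorics is needed. -/
theorem axialDistance_ne_zero (T : Option (Option γ) ≃ lam.cells) (rho : lowerCovers lam)
    (sigma : lowerCovers rho.1) : axialDistance rho sigma ≠ 0 := by
  intro h0
  have h := axialDistance_smul T rho sigma 1
  rw [h0, zero_smul, leftAct_one] at h
  set T2 := filling γ sigma.1 (card_lower (filling _ rho.1 (card_lower T rho)) sigma)
  have h1 := LinearMap.congr_fun h (⟨youngSymmetrizer T2, mem_specht.2 ⟨1, one_mul _⟩⟩ : specht T2)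
  have h2 : 0 = youngSymmetrizer T2 := congrArg Subtype.val h1
  simpa [← h2] using coeff_one_youngSymmetrizer T2

theorem axialDistance_mul_trace (v : ℂ[Equiv.Perm γ]) :
    axialDistance rho sigma * LinearMap.trace ℂ _
      (lowerProj (filling _ rho.1 (card_lower T rho)) sigma ∘ₗ (lowerProj T rho ∘ₗ
      leftAct T (incl (incl v) * MonoidAlgebra.single (topSwap γ) 1) ∘ₗ lowerMap T rho) ∘ₗ
      lowerMap (filling _ rho.1 (card_lower T rho)) sigma) =
    spechtTrace (filling γ sigma.1 (card_lower (filling _ rho.1 (card_lower T rho)) sigma)) v := by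
  have h := congrArg (LinearMap.trace ℂ _) (axialDistance_smul T rho sigma v)
  rw [map_smul] at h
  exact h

/-- The character of an element of the smaller group times the added transposition. -/
theorem spechtTrace_mul_topSwap (v : ℂ[Equiv.Perm γ]) :
    spechtTrace T (incl (incl v) * MonoidAlgebra.single (topSwap γ) 1) =
      ∑ rho : lowerCovers lam, ∑ sigma : lowerCovers rho.1,
        spechtTrace (filling γ sigma.1 (card_lower (filling _ rho.1 (card_lower T rho)) sigma)) v /
          axialDistance rho sigma := by
  refine (trace_eq_sum_lowerCovers T _).trans (Finset.sum_congr rfl fun rho _ => ?_)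
  refine (trace_eq_sum_lowerCovers (filling _ rho.1 (card_lower T rho)) _).trans
    (Finset.sum_congr rfl fun sigma _ => ?_)
  refine eq_div_of_mul_eq (axialDistance_ne_zero T rho sigma) ?_
  rw [mul_comm]
  exact axialDistance_mul_trace T rho sigma v

end TwoStep

/-! ### Paths that remove two boxes, and their weights -/

section TwoBoxes

variable {lam rho sigma : YoungDiagram}

/-- The reciprocal of the difference of the contents of the two boxes along a path. -/
def pathWeight (lam rho sigma : YoungDiagram) : ℂ :=
  2 / (swapEigenvalue lam - 2 * swapEigenvalue rho + swapEigenvalue sigma)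

/-- The second difference of `swapEigenvalue` is twice the difference of the contents. This form of
the weight needs no proofs of covering, so sums over paths can run over plain finite sets. -/
theorem pathWeight_eq (h : IsCover rho lam) (h' : IsCover sigma rho) :
    pathWeight lam rho sigma = 1 / ((content h.box : ℂ) - content h'.box) := by
  rw [pathWeight, h.swapEigenvalue_eq, h'.swapEigenvalue_eq,
    ← mul_div_mul_left (1 : ℂ) _ (two_ne_zero' ℂ)]
  congr 1 <;> ring

/-- The diagrams between `sigma` and `lam` that differ from each of them by one box. -/
def middles (sigma lam : YoungDiagram) : Finset YoungDiagram :=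
  (lowerCovers lam).filter (IsCover sigma)

theorem mem_middles : rho ∈ middles sigma lam ↔ IsCover rho lam ∧ IsCover sigma rho := by
  rw [middles, Finset.mem_filter, mem_lowerCovers]

theorem sdiff_eq_pair_symm {a b : ℕ × ℕ} (hd : lam.cells \ sigma.cells = {a, b}) :
    lam.cells \ sigma.cells = {b, a} := by
  rw [hd, Finset.pair_comm]

theorem mem_iff_of_sdiff {a b : ℕ × ℕ} (hle : sigma ≤ lam)
    (hd : lam.cells \ sigma.cells = {a, b}) (x : ℕ × ℕ) :
    x ∈ lam.cells ↔ x ∈ sigma.cells ∨ x = a ∨ x = b := by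
  have h := Finset.ext_iff.1 hd x
  have hs : x ∈ sigma.cells → x ∈ lam.cells := fun h => YoungDiagram.cells_subset_iff.2 hle h
  simp only [Finset.mem_sdiff, Finset.mem_insert, Finset.mem_singleton] at h
  tauto

theorem notMem_of_sdiff {a b : ℕ × ℕ} (hd : lam.cells \ sigma.cells = {a, b}) :
    a ∉ sigma.cells ∧ b ∉ sigma.cells := by
  have ha := Finset.ext_iff.1 hd a
  have hb := Finset.ext_iff.1 hd b
  simp only [Finset.mem_sdiff, Finset.mem_insert, Finset.mem_singleton] at ha hb
  tauto

theorem cells_eq_of_mem_middles {a b : ℕ × ℕ} (hd : lam.cells \ sigma.cells = {a, b})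
    (hr : rho ∈ middles sigma lam) :
    rho.cells = insert a sigma.cells ∨ rho.cells = insert b sigma.cells := by
  obtain ⟨h, h'⟩ := mem_middles.1 hr
  have hb : h'.box ∈ lam.cells \ sigma.cells := by
    rw [Finset.mem_sdiff, h.cells_eq, h'.cells_eq]
    exact ⟨Finset.mem_insert_of_mem (Finset.mem_insert_self _ _), h'.box_notMem⟩
  rw [hd, Finset.mem_insert, Finset.mem_singleton] at hb
  rw [h'.cells_eq]
  exact hb.imp (fun h => by rw [h]) fun h => by rw [h]

/-- The box `a` may be added before `b` unless `b` precedes it. Comparable boxes thus allow one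
order, incomparable ones both. -/
theorem exists_mem_middles {a b : ℕ × ℕ} (hle : sigma ≤ lam)
    (hd : lam.cells \ sigma.cells = {a, b}) (hba : ¬ b ≤ a) :
    ∃ rho ∈ middles sigma lam, rho.cells = insert a sigma.cells ∧
      pathWeight lam rho sigma = 1 / ((content b : ℂ) - content a) := by
  have hmem := mem_iff_of_sdiff hle hd
  obtain ⟨ha, hb⟩ := notMem_of_sdiff hd
  have hne : b ≠ a := fun h => hba h.le
  let rho : YoungDiagram := ⟨insert a sigma.cells, fun x y hyx hx => by
    simp only [Finset.coe_insert, Set.mem_insert_iff, Finset.mem_coe] at hx ⊢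
    rcases hx with rfl | hx
    · have hy : y ∈ lam.cells := lam.isLowerSet hyx ((hmem x).2 (Or.inr (Or.inl rfl)))
      rcases (hmem y).1 hy with h | h | h
      · exact Or.inr h
      · exact Or.inl h
      · exact absurd (h ▸ hyx) hba
    · exact Or.inr (sigma.isLowerSet hyx hx)⟩
  have hb' : b ∉ rho.cells := by
    change b ∉ insert a sigma.cells
    simp [hne, hb]
  have h' : IsCover sigma rho := isCover_of_cells_eq ha rfl
  have h : IsCover rho lam := isCover_of_cells_eq hb' (by
    ext x
    rw [hmem x]
    change _ ↔ x ∈ insert b (insert a sigma.cells)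
    simp only [Finset.mem_insert]
    tauto)
  refine ⟨rho, mem_middles.2 ⟨h, h'⟩, rfl, ?_⟩
  rw [pathWeight_eq h h', h.box_eq hb' ((hmem b).2 (Or.inr (Or.inr rfl))),
    h'.box_eq ha (Finset.mem_insert_self _ _)]

theorem middles_of_le {a b : ℕ × ℕ} (hle : sigma ≤ lam)
    (hd : lam.cells \ sigma.cells = {a, b}) (hab : a ≤ b) (hne : a ≠ b) :
    ∃ rho, middles sigma lam = {rho} ∧
      pathWeight lam rho sigma = 1 / ((content b : ℂ) - content a) := by
  obtain ⟨rho, h1, h2, h3⟩ := exists_mem_middles hle hd fun h => hne (le_antisymm hab h)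
  refine ⟨rho, Finset.eq_singleton_iff_unique_mem.2 ⟨h1, fun tau ht => ?_⟩, h3⟩
  rcases cells_eq_of_mem_middles hd ht with h | h
  · exact YoungDiagram.ext (h.trans h2.symm)
  · have ha : a ∈ tau.cells :=
      tau.isLowerSet hab (Finset.mem_coe.2 (h ▸ Finset.mem_insert_self b sigma.cells))
    rw [h, Finset.mem_insert] at ha
    exact absurd ha (not_or.2 ⟨hne, (notMem_of_sdiff hd).1⟩)

theorem middles_of_incomparable {a b : ℕ × ℕ} (hle : sigma ≤ lam)
    (hd : lam.cells \ sigma.cells = {a, b}) (hab : ¬ a ≤ b) (hba : ¬ b ≤ a) :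
    ∃ rho rho', rho ≠ rho' ∧ middles sigma lam = {rho, rho'} ∧
      pathWeight lam rho sigma = 1 / ((content b : ℂ) - content a) ∧
      pathWeight lam rho' sigma = 1 / ((content a : ℂ) - content b) := by
  obtain ⟨rho, h1, h2, h3⟩ := exists_mem_middles hle hd hba
  obtain ⟨rho', h1', h2', h3'⟩ := exists_mem_middles hle (sdiff_eq_pair_symm hd) hab
  refine ⟨rho, rho', ?_, ?_, h3, h3'⟩
  · rintro rfl
    have ha : a ∈ rho.cells := h2 ▸ Finset.mem_insert_self _ _
    rw [h2', Finset.mem_insert] at ha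
    exact absurd ha (not_or.2 ⟨fun h => hab h.le, (notMem_of_sdiff hd).1⟩)
  · ext tau
    rw [Finset.mem_insert, Finset.mem_singleton]
    refine ⟨fun ht => (cells_eq_of_mem_middles hd ht).imp
      (fun h => YoungDiagram.ext (h.trans h2.symm))
      fun h => YoungDiagram.ext (h.trans h2'.symm), ?_⟩
    rintro (rfl | rfl)
    exacts [h1, h1']

/-- The two boxes are not strictly ordered in both coordinates. -/
theorem not_lt_of_sdiff {a b : ℕ × ℕ} (hle : sigma ≤ lam)
    (hd : lam.cells \ sigma.cells = {a, b}) (h1 : a.1 ≠ b.1) (h2 : a.2 ≠ b.2) : ¬ a ≤ b := by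
  intro hab
  have hmem := mem_iff_of_sdiff hle hd
  -- The corner between the two boxes would be a third box of the skew shape.
  have hc : (a.1, b.2) ∈ lam.cells :=
    lam.isLowerSet (a := b) ⟨hab.1, le_rfl⟩ ((hmem b).2 (Or.inr (Or.inr rfl)))
  rcases (hmem _).1 hc with h | h | h
  · exact (notMem_of_sdiff hd).1 (sigma.isLowerSet (a := (a.1, b.2)) ⟨le_rfl, hab.2⟩ h)
  · exact h2 (congrArg Prod.snd h :).symm
  · exact h1 (congrArg Prod.fst h :)

/-- The diagrams with two boxes less. -/
def secondLower (lam : YoungDiagram) : Finset YoungDiagram :=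
  (subdiagrams lam).filter fun sigma => lam.card = sigma.card + 2

theorem card_sdiff_eq (hle : sigma ≤ lam) :
    (lam.cells \ sigma.cells).card + sigma.card = lam.card :=
  Finset.card_sdiff_add_card_eq_card (YoungDiagram.cells_subset_iff.2 hle)

/-- The right neighbour of `a` lies in `lam` but not in `sigma`, so it must be `b`. -/
theorem shape_of_snd_lt {a b : ℕ × ℕ} (hle : sigma ≤ lam)
    (hd : lam.cells \ sigma.cells = {a, b}) (h1 : a.1 = b.1) (h2 : a.2 < b.2) :
    IsHorizontalDomino lam sigma := by
  have hmem := mem_iff_of_sdiff hle hd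
  have hc : (a.1, a.2 + 1) ∈ lam.cells :=
    lam.isLowerSet (a := b) ⟨h1.le, h2⟩ ((hmem b).2 (Or.inr (Or.inr rfl)))
  rcases (hmem _).1 hc with h | h | h
  · exact absurd (sigma.isLowerSet (a := (a.1, a.2 + 1)) (b := a) ⟨le_rfl, Nat.le_succ _⟩ h)
      (notMem_of_sdiff hd).1
  · have := congrArg Prod.snd h
    simp at this
  · exact ⟨a.1, a.2, by rw [hd, h]⟩

theorem shape_of_fst_lt {a b : ℕ × ℕ} (hle : sigma ≤ lam)
    (hd : lam.cells \ sigma.cells = {a, b}) (h1 : a.2 = b.2) (h2 : a.1 < b.1) :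
    IsVerticalDomino lam sigma := by
  have hmem := mem_iff_of_sdiff hle hd
  have hc : (a.1 + 1, a.2) ∈ lam.cells :=
    lam.isLowerSet (a := b) ⟨h2, h1.le⟩ ((hmem b).2 (Or.inr (Or.inr rfl)))
  rcases (hmem _).1 hc with h | h | h
  · exact absurd (sigma.isLowerSet (a := (a.1 + 1, a.2)) (b := a) ⟨Nat.le_succ _, le_rfl⟩ h)
      (notMem_of_sdiff hd).1
  · have := congrArg Prod.fst h
    simp at this
  · exact ⟨a.1, a.2, by rw [hd, h]⟩

theorem secondLower_eq (lam : YoungDiagram) :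
    secondLower lam = (horizontalRemovals lam ∪ verticalRemovals lam) ∪ twoBoxRemovals lam := by
  ext sigma
  simp only [secondLower, horizontalRemovals, verticalRemovals, twoBoxRemovals, Finset.mem_union,
    Finset.mem_filter, ← and_or_left, mem_subdiagrams]
  refine and_congr_right fun hle => ⟨fun hc => ?_, fun h => ?_⟩
  · have h2 : (lam.cells \ sigma.cells).card = 2 := by
      have := card_sdiff_eq hle
      omega
    obtain ⟨a, b, hne, hd⟩ := Finset.card_eq_two.1 h2
    by_cases h1 : a.1 = b.1
    · rcases lt_or_gt_of_ne fun h2 : a.2 = b.2 => hne (Prod.ext h1 h2) with h2 | h2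
      · exact Or.inl (Or.inl (shape_of_snd_lt hle hd h1 h2))
      · exact Or.inl (Or.inl (shape_of_snd_lt hle (sdiff_eq_pair_symm hd) h1.symm h2))
    · by_cases h2 : a.2 = b.2
      · rcases lt_or_gt_of_ne h1 with h1 | h1
        · exact Or.inl (Or.inr (shape_of_fst_lt hle hd h2 h1))
        · exact Or.inl (Or.inr (shape_of_fst_lt hle (sdiff_eq_pair_symm hd) h2.symm h1))
      · exact Or.inr ⟨a, b, h1, h2, hd⟩
  · have := card_sdiff_eq hle
    have h2 : (lam.cells \ sigma.cells).card = 2 := by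
      rcases h with (⟨i, j, hd⟩ | ⟨i, j, hd⟩) | ⟨a, b, h1, -, hd⟩
      · rw [hd, Finset.card_pair (by simp)]
      · rw [hd, Finset.card_pair (by simp)]
      · rw [hd, Finset.card_pair fun h => h1 (by rw [h])]
    omega

theorem disjoint_horizontal_vertical (lam : YoungDiagram) :
    Disjoint (horizontalRemovals lam) (verticalRemovals lam) := by
  rw [Finset.disjoint_left]
  intro sigma h1 h2
  obtain ⟨i, j, hd⟩ := (Finset.mem_filter.1 h1).2
  obtain ⟨i', j', hd'⟩ := (Finset.mem_filter.1 h2).2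
  have e1 : (i', j') ∈ lam.cells \ sigma.cells := by simp [hd']
  have e2 : (i' + 1, j') ∈ lam.cells \ sigma.cells := by simp [hd']
  rw [hd] at e1 e2
  simp only [Finset.mem_insert, Finset.mem_singleton, Prod.mk.injEq] at e1 e2
  omega

theorem disjoint_twoBox (lam : YoungDiagram) :
    Disjoint (horizontalRemovals lam ∪ verticalRemovals lam) (twoBoxRemovals lam) := by
  rw [Finset.disjoint_left]
  intro sigma h1 h2
  obtain ⟨a, b, hne1, hne2, hd'⟩ := (Finset.mem_filter.1 h2).2
  have e1 : a ∈ lam.cells \ sigma.cells := by simp [hd']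
  have e2 : b ∈ lam.cells \ sigma.cells := by simp [hd']
  rcases Finset.mem_union.1 h1 with h1 | h1
  all_goals
    obtain ⟨i, j, hd⟩ := (Finset.mem_filter.1 h1).2
    rw [hd] at e1 e2
    simp only [Finset.mem_insert, Finset.mem_singleton, Prod.ext_iff] at e1 e2
    omega

theorem sum_paths_eq (lam : YoungDiagram) (F : YoungDiagram → YoungDiagram → ℂ) :
    ∑ rho ∈ lowerCovers lam, ∑ sigma ∈ lowerCovers rho, F rho sigma =
      ∑ sigma ∈ horizontalRemovals lam, ∑ rho ∈ middles sigma lam, F rho sigma +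
      ∑ sigma ∈ verticalRemovals lam, ∑ rho ∈ middles sigma lam, F rho sigma +
      ∑ sigma ∈ twoBoxRemovals lam, ∑ rho ∈ middles sigma lam, F rho sigma := by
  rw [← Finset.sum_union (disjoint_horizontal_vertical lam),
    ← Finset.sum_union (disjoint_twoBox lam), ← secondLower_eq]
  refine Finset.sum_comm' fun rho sigma => ?_
  rw [mem_middles, mem_lowerCovers, mem_lowerCovers, secondLower, Finset.mem_filter,
    mem_subdiagrams]
  refine ⟨fun h => ⟨h, h.2.1.trans h.1.1, ?_⟩, fun h => h.1⟩
  have h1 := h.1.2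
  have h2 := h.2.2
  omega

theorem middles_horizontal (h : sigma ∈ horizontalRemovals lam) :
    ∃ rho, middles sigma lam = {rho} ∧ pathWeight lam rho sigma = 1 := by
  obtain ⟨hle, i, j, hd⟩ := Finset.mem_filter.1 h
  obtain ⟨rho, h1, h2⟩ := middles_of_le (mem_subdiagrams.1 hle) hd
    ⟨le_rfl, Nat.le_succ _⟩ (by simp)
  exact ⟨rho, h1, by rw [h2]; simp [content]⟩

theorem middles_vertical (h : sigma ∈ verticalRemovals lam) :
    ∃ rho, middles sigma lam = {rho} ∧ pathWeight lam rho sigma = -1 := by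
  obtain ⟨hle, i, j, hd⟩ := Finset.mem_filter.1 h
  obtain ⟨rho, h1, h2⟩ := middles_of_le (mem_subdiagrams.1 hle) hd
    ⟨Nat.le_succ _, le_rfl⟩ (by simp)
  exact ⟨rho, h1, by
    rw [h2, show (content (i + 1, j) : ℂ) - content (i, j) = -1 by simp [content]]
    norm_num⟩

theorem middles_twoBox (h : sigma ∈ twoBoxRemovals lam) :
    ∃ rho rho', rho ≠ rho' ∧ middles sigma lam = {rho, rho'} ∧
      pathWeight lam rho sigma + pathWeight lam rho' sigma = 0 := by
  obtain ⟨hle, a, b, h1, h2, hd⟩ := Finset.mem_filter.1 h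
  have hle := mem_subdiagrams.1 hle
  obtain ⟨rho, rho', h3, h4, h5, h6⟩ := middles_of_incomparable hle hd
    (not_lt_of_sdiff hle hd h1 h2)
    (not_lt_of_sdiff hle (sdiff_eq_pair_symm hd) h1.symm h2.symm)
  refine ⟨rho, rho', h3, h4, ?_⟩
  rw [h5, h6, ← neg_sub (content b : ℂ), div_neg, add_neg_cancel]

theorem sum_paths (lam : YoungDiagram) (f : YoungDiagram → ℂ) :
    ∑ rho ∈ lowerCovers lam, ∑ sigma ∈ lowerCovers rho, f sigma =
      ∑ sigma ∈ horizontalRemovals lam, f sigma + ∑ sigma ∈ verticalRemovals lam, f sigma +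
      2 * ∑ sigma ∈ twoBoxRemovals lam, f sigma := by
  rw [sum_paths_eq, Finset.mul_sum]
  congr 1
  · congr 1
    · refine Finset.sum_congr rfl fun sigma h => ?_
      obtain ⟨rho, h1, -⟩ := middles_horizontal h
      rw [h1, Finset.sum_singleton]
    · refine Finset.sum_congr rfl fun sigma h => ?_
      obtain ⟨rho, h1, -⟩ := middles_vertical h
      rw [h1, Finset.sum_singleton]
  · refine Finset.sum_congr rfl fun sigma h => ?_
    obtain ⟨rho, rho', hne, h1, -⟩ := middles_twoBox h
    rw [h1, Finset.sum_pair hne, two_mul]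

theorem sum_paths_weight (lam : YoungDiagram) (f : YoungDiagram → ℂ) :
    ∑ rho ∈ lowerCovers lam, ∑ sigma ∈ lowerCovers rho, f sigma * pathWeight lam rho sigma =
      ∑ sigma ∈ horizontalRemovals lam, f sigma - ∑ sigma ∈ verticalRemovals lam, f sigma := by
  rw [sum_paths_eq, sub_eq_add_neg, ← Finset.sum_neg_distrib]
  conv_rhs => rw [← add_zero (_ + _)]
  congr 1
  · congr 1
    · refine Finset.sum_congr rfl fun sigma h => ?_
      obtain ⟨rho, h1, h2⟩ := middles_horizontal h
      rw [h1, Finset.sum_singleton, h2, mul_one]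
    · refine Finset.sum_congr rfl fun sigma h => ?_
      obtain ⟨rho, h1, h2⟩ := middles_vertical h
      rw [h1, Finset.sum_singleton, h2, mul_neg_one]
  · refine Finset.sum_eq_zero fun sigma h => ?_
    obtain ⟨rho, rho', hne, h1, h2⟩ := middles_twoBox h
    rw [h1, Finset.sum_pair hne, ← mul_add, h2, mul_zero]

end TwoBoxes

/-! ### Recursion for the characters at involutions -/

section Characters

variable {γ : Type*} [Fintype γ] [DecidableEq γ] {lam : YoungDiagram}

theorem cycleType_optionCongr (g : Equiv.Perm γ) :
    Equiv.Perm.cycleType (Equiv.optionCongr g) = g.cycleType := by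
  have h : Equiv.optionCongr g = g.extendDomain (Equiv.optionIsSomeEquiv γ).symm := by
    ext1 x
    rcases x with _ | a
    · rw [Equiv.Perm.extendDomain_apply_not_subtype _ _ (by simp)]
      rfl
    · exact (g.extendDomain_apply_image (Equiv.optionIsSomeEquiv γ).symm a).symm
  rw [h, Equiv.Perm.cycleType_extendDomain]

theorem cycleType_mul_topSwap (g : Equiv.Perm γ) {s : ℕ}
    (hg : g.cycleType = Multiset.replicate s 2) :
    Equiv.Perm.cycleType (Equiv.optionCongr (Equiv.optionCongr g) * topSwap γ) =
      Multiset.replicate (s + 1) 2 := by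
  have hd : Equiv.Perm.Disjoint (Equiv.optionCongr (Equiv.optionCongr g)) (topSwap γ) := by
    rintro (_ | _ | a)
    · exact Or.inl rfl
    · exact Or.inl rfl
    · exact Or.inr (Equiv.swap_apply_of_ne_of_ne (by simp) (by simp))
  have hs : (topSwap γ).IsSwap := ⟨none, some none, by simp, rfl⟩
  rw [hd.cycleType_mul, cycleType_optionCongr, cycleType_optionCongr, hg,
    Equiv.Perm.isSwap_iff_cycleType.1 hs, Multiset.replicate_succ, add_comm]
  rfl

theorem exists_involution {s : ℕ} (hs : 2 * s ≤ Fintype.card γ) :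
    ∃ g : Equiv.Perm γ, g.cycleType = Multiset.replicate s 2 := by
  rw [Equiv.Perm.exists_with_cycleType_iff]
  refine ⟨by simpa [mul_comm] using hs, fun a ha => (Multiset.eq_of_mem_replicate ha).ge⟩

/-- The bound on `s` provides an involution on `m` points. Fixing the two added points or swapping
them gives the two classes. -/
theorem charInvolution_recursion {s m : ℕ} (hlam : lam.card = m + 2) (hs : 2 * s ≤ m) :
    charInvolution lam s = ∑ rho ∈ lowerCovers lam, ∑ sigma ∈ lowerCovers rho,
      charInvolution sigma s ∧
    charInvolution lam (s + 1) = ∑ rho ∈ lowerCovers lam, ∑ sigma ∈ lowerCovers rho,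
      charInvolution sigma s * pathWeight lam rho sigma := by
  obtain ⟨g, hg⟩ := exists_involution (γ := Fin m) (s := s) (by simpa using hs)
  let T : Option (Option (Fin m)) ≃ lam.cells := filling _ _ (by simp [hlam])
  constructor
  · rw [charInvolution_eq_spechtTrace T (g := Equiv.optionCongr (Equiv.optionCongr g))
      (by rw [cycleType_optionCongr, cycleType_optionCongr, hg]), ← incl_single, ← incl_single,
      spechtTrace_incl, ← Finset.sum_coe_sort (lowerCovers lam)]
    refine Finset.sum_congr rfl fun rho _ => ?_
    rw [spechtTrace_incl, ← Finset.sum_coe_sort (lowerCovers rho.1)]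
    refine Finset.sum_congr rfl fun sigma _ => ?_
    rw [charInvolution_eq_spechtTrace _ hg]
  · rw [charInvolution_eq_spechtTrace T (cycleType_mul_topSwap g hg)]
    have h := spechtTrace_mul_topSwap T (MonoidAlgebra.single g 1)
    rw [incl_single, incl_single, MonoidAlgebra.single_mul_single, mul_one] at h
    rw [h, ← Finset.sum_coe_sort (lowerCovers lam)]
    refine Finset.sum_congr rfl fun rho _ => ?_
    rw [← Finset.sum_coe_sort (lowerCovers rho.1)]
    refine Finset.sum_congr rfl fun sigma _ => ?_
    rw [charInvolution_eq_spechtTrace _ hg,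
      pathWeight_eq (mem_lowerCovers.1 rho.2) (mem_lowerCovers.1 sigma.2), axialDistance,
      mul_one_div]

end Characters

/-! ### Binomial sums and the recursion for the eigenvalues -/

section Eigenvalue

variable {lam : YoungDiagram}

/-- Pascal's rule for binomial sums. -/
theorem sum_binomial_succ (p q : ℂ) (m : ℕ) (f : ℕ → ℂ) :
    ∑ s ∈ Finset.range (m + 1 + 1), p ^ (m + 1 - s) * q ^ s * ((m + 1).choose s : ℂ) * f s =
      ∑ s ∈ Finset.range (m + 1), p ^ (m - s) * q ^ s * (m.choose s : ℂ) *
        (p * f s + q * f (s + 1)) := by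
  -- Shifting the index splits off `s = 0`; the extra last term vanishes because `m.choose (m + 1) =
  -- 0`.
  have h1 : ∑ s ∈ Finset.range (m + 1), p ^ (m - s) * q ^ s * (m.choose s : ℂ) * (p * f s) =
      ∑ s ∈ Finset.range (m + 1), p ^ (m - s) * q ^ (s + 1) * (m.choose (s + 1) : ℂ) * f (s + 1) +
        p ^ (m + 1) * f 0 := by
    have h2 : ∀ s ∈ Finset.range (m + 1), p ^ (m - s) * q ^ s * (m.choose s : ℂ) * (p * f s) =
        p ^ (m + 1 - s) * q ^ s * (m.choose s : ℂ) * f s := fun s hs => by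
      rw [Nat.succ_sub (Finset.mem_range_succ_iff.1 hs), pow_succ]
      ring
    have h3 := Finset.sum_range_succ
      (fun s => p ^ (m + 1 - s) * q ^ s * (m.choose s : ℂ) * f s) (m + 1)
    rw [Finset.sum_range_succ'] at h3
    rw [Finset.sum_congr rfl h2]
    simpa using h3.symm
  simp only [mul_add]
  rw [Finset.sum_add_distrib, h1, Finset.sum_range_succ', add_right_comm,
    ← Finset.sum_add_distrib]
  congr 1
  · refine Finset.sum_congr rfl fun s _ => ?_
    rw [Nat.choose_succ_succ, Nat.add_sub_add_right]
    push_cast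
    ring
  · simp

/-- The eigenvalue times the dimension. -/
theorem psi_mul_dim (p : ℝ) (lam : YoungDiagram) {m : ℕ} (h : lam.card / 2 = m) :
    psi p lam * dim lam = ∑ s ∈ Finset.range (m + 1),
      (p : ℂ) ^ (m - s) * (1 - (p : ℂ)) ^ s * (m.choose s : ℂ) * charInvolution lam s := by
  have hd : (dim lam : ℂ) ≠ 0 := Nat.cast_ne_zero.2 (dim_ne_zero lam)
  rw [psi, h, Finset.sum_mul]
  refine Finset.sum_congr rfl fun s _ => ?_
  rw [mul_assoc, div_mul_cancel₀ _ hd]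

theorem psi_mul_dim_recursion (p : ℝ) {m : ℕ} (hlam : lam.card = 2 * m + 2) :
    psi p lam * dim lam =
      ∑ rho ∈ horizontalRemovals lam, psi p rho * dim rho +
      (2 * (p : ℂ) - 1) * ∑ rho ∈ verticalRemovals lam, psi p rho * dim rho +
      2 * (p : ℂ) * ∑ rho ∈ twoBoxRemovals lam, psi p rho * dim rho := by
  have hcard : ∀ sigma ∈ secondLower lam, sigma.card / 2 = m := fun sigma h => by
    have := (Finset.mem_filter.1 h).2
    omega
  rw [secondLower_eq] at hcard
  have hH := Finset.sum_congr (rfl : horizontalRemovals lam = _) fun sigma h =>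
    psi_mul_dim p sigma (hcard sigma (by simp [h]))
  have hV := Finset.sum_congr (rfl : verticalRemovals lam = _) fun sigma h =>
    psi_mul_dim p sigma (hcard sigma (by simp [h]))
  have hT := Finset.sum_congr (rfl : twoBoxRemovals lam = _) fun sigma h =>
    psi_mul_dim p sigma (hcard sigma (by simp [h]))
  rw [hH, hV, hT, psi_mul_dim p lam (m := m + 1) (by omega), sum_binomial_succ,
    Finset.sum_comm, Finset.sum_comm (s := verticalRemovals lam),
    Finset.sum_comm (s := twoBoxRemovals lam), Finset.mul_sum, Finset.mul_sum,
    ← Finset.sum_add_distrib, ← Finset.sum_add_distrib]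
  refine Finset.sum_congr rfl fun s hs => ?_
  have hs : s ≤ m := Finset.mem_range_succ_iff.1 hs
  obtain ⟨h1, h2⟩ := charInvolution_recursion (s := s) hlam (by omega)
  rw [sum_paths lam fun sigma => charInvolution sigma s] at h1
  rw [sum_paths_weight lam fun sigma => charInvolution sigma s] at h2
  -- What remains is $p(H+V+2T) + (1-p)(H-V) = H + (2p-1)V + 2pT$ for each `s`.
  rw [h1, h2, ← Finset.mul_sum, ← Finset.mul_sum, ← Finset.mul_sum]
  ring

end Eigenvalue

end

end InvolutionWalk

theorem mainTheorem7 (p : ℝ) (n : ℕ) (hn : Even n) (hn2 : 2 ≤ n)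
    (lam : YoungDiagram) (hlam : lam.card = n) :
    InvolutionWalk.psi p lam =
      (∑ rho ∈ InvolutionWalk.horizontalRemovals lam,
        InvolutionWalk.psi p rho *
          ((InvolutionWalk.dim rho : ℂ) / (InvolutionWalk.dim lam : ℂ))) +
      (2 * (p : ℂ) - 1) * (∑ rho ∈ InvolutionWalk.verticalRemovals lam,
        InvolutionWalk.psi p rho *
          ((InvolutionWalk.dim rho : ℂ) / (InvolutionWalk.dim lam : ℂ))) +
      2 * (p : ℂ) * (∑ rho ∈ InvolutionWalk.twoBoxRemovals lam,
        InvolutionWalk.psi p rho *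
          ((InvolutionWalk.dim rho : ℂ) / (InvolutionWalk.dim lam : ℂ))) := by
  obtain ⟨k, hk⟩ := hn
  -- Since `n = k + k` and `2 ≤ n`, the truncated subtraction is exact and `n = 2 * (k - 1) + 2`.
  have h := InvolutionWalk.psi_mul_dim_recursion p (lam := lam) (m := k - 1) (by omega)
  have hd : (InvolutionWalk.dim lam : ℂ) ≠ 0 :=
    Nat.cast_ne_zero.2 (InvolutionWalk.dim_ne_zero lam)
  simp only [← mul_div_assoc, ← Finset.sum_div]
  rw [← add_div, ← add_div, eq_div_iff hd, h]
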